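/- Let $X$ be a compact metric space and let $\mathcal F=\{\phi_i\}_{i\in\mathbb N}$ be an infinite sequence of Lipschitz maps $\phi_i:X\to X$ with $\operatorname{Lip}(\phi_i)\in(0,1)$ for every $i$, where $\operatorname{Lip}(\phi)$ denotes the infimum of all $L>0$ for which $\phi$ is $L$-Lipschitz (the maps need not be injective). Let $$K=\bigcup_{(i_n)\in\mathbb N^{\mathbb N}}\ \bigcap_{n=1}^{\infty}\phi_{i_1}\circ\cdots\circ\phi_{i_n}(X)$$ be the attractor of $\mathcal F$, and let $$\operatorname{sdim}(\mathcal F)=\inf\Big\{t\ge 0:\ \sum_{i\in\mathbb N}\operatorname{Lip}(\phi_i)^t\le 1\Big\}\in[0,\infty]$$ be its similarity dimension, with $\inf\emptyset=\infty$. Suppose that $K$ is compact, that $\lim_{i\to\infty}\operatorname{Lip}(\phi_i)=0$, and that there is a continuous map $\gamma:[0,1]\to K$ whose image intersects $\phi_i(K)$ for every $i$. Then: 1. $K$ is the image of $[0,1]$ under a continuous map. 2. If $\gamma$ is $\frac1s$-Hölder for some $s\ge 1$ (that is, there is a finite constant $C$ with $d(\gamma(x),\gamma(y))\le C|x-y|^{1/s}$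 for all $x,y\in[0,1]$), then for every real $\alpha>\max\{s,\operatorname{sdim}(\mathcal F)\}$ the set $K$ is the image of $[0,1]$ under a $\frac1\alpha$-Hölder map. -/

import Mathlib

open scoped NNReal ENNReal unitInterval

noncomputable section

namespace IIFS

variable {X : Type*} [MetricSpace X]

/-- The optimal Lipschitz constant of a map: the infimum of all `L > 0` for which `f` is
`L`-Lipschitz. It is only used for Lipschitz maps, for which the set is nonempty. -/
def lip (f : X → X) : ℝ≥0 :=
  sInf {L : ℝ≥0 | 0 < L ∧ LipschitzWith L f}

/-- The sequence `φ` is an infinite iterated function system of nondegenerate proper contractions: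
every map is Lipschitz, with optimal Lipschitz constant in `(0, 1)`. The maps are not required to be
injective. -/
structure IsIIFS (φ : ℕ → X → X) : Prop where
  lipschitz : ∀ i, ∃ L : ℝ≥0, LipschitzWith L (φ i)
  lip_pos : ∀ i, 0 < lip (φ i)
  lip_lt_one : ∀ i, lip (φ i) < 1

/-- The composition `φ (w 0) ∘ ⋯ ∘ φ (w (n - 1))` of the first `n` maps along an infinite word
`w`; for `n = 0` it is the identity. -/
def wordMap (φ : ℕ → X → X) (w : ℕ → ℕ) : ℕ → X → X
  | 0 => id
  | n + 1 => wordMap φ w n ∘ φ (w n)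

/-- The attractor: the union over all infinite words `w` of the intersection over `n ≥ 1` of
`φ (w 0) ∘ ⋯ ∘ φ (w (n - 1)) (X)`. -/
def attractor (φ : ℕ → X → X) : Set X :=
  ⋃ w : ℕ → ℕ, ⋂ n : ℕ, Set.range (wordMap φ w (n + 1))

/-- The function `ψ(t) = ∑ i, Lip(φ i) ^ t`, with values in `[0, ∞]`. -/
def psi (φ : ℕ → X → X) (t : ℝ≥0) : ℝ≥0∞ :=
  ∑' i, (lip (φ i) : ℝ≥0∞) ^ (t : ℝ)

/-- The similarity dimension `inf {t ≥ 0 : ψ(t) ≤ 1}`, with values in `[0, ∞]`; it is `∞` when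
there is no such `t`. -/
def sdim (φ : ℕ → X → X) : ℝ≥0∞ :=
  sInf ((fun t : ℝ≥0 => (t : ℝ≥0∞)) '' {t : ℝ≥0 | psi φ t ≤ 1})

/-- A map of the unit interval is `r`-Hölder if it is Hölder with exponent `r` and some finite
constant. -/
def IsHolder (r : ℝ≥0) (f : I → X) : Prop :=
  ∃ C : ℝ≥0, HolderWith C r f

end IIFS

end

/-! ### Fixed points without continuity, and limits of approximate estimates. -/

namespace IIFS

/-! Write `K` for the attractor. It suffices to build a curve `f` in `K` whose image contains the
image under every `φ i` of a sufficiently large part of itself: such an image is dense, and being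
compact it is `K`. So `f` is sought as a fixed point, with rescaled copies of `φ i ∘ f` placed on
disjoint time intervals.

For the copies to fit, a base curve `Γ` must be constant on the `i`-th interval, with value `φ i` of
the common value of `f` at times 0 and 1. `Γ` is made from `γ`: the time on `γ` stops when `γ` meets
`φ i (K)`, and an excursion inside `φ i (K)` leads to `φ i (γ 0)`, waits there and returns
(`exists_dwelling_curve`).

Excursions need arcs inside `K`. Two coded points are joined recursively: if their first letters
agree, the common map is applied to an arc between the shifted points; otherwise the arc goes inside
the first piece to a point of `γ`, along `γ`, and inside the second piece to the end
(`IsArcFamily`).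

Both recursions contract the uniform distance, so solutions exist with no regularity assumed.
Regularity is then proved up to an error `r ^ n * D` by induction on `n`. For continuity, `Lip(φ i)
→ 0` leaves finitely many pieces to control. For exponent `ρ`, compressing time by `l` multiplies
the Hölder constant by `l ^ (-ρ)`, which `φ i` absorbs if `Lip(φ i) ≤ l ^ ρ`. With `ρ = 1 / α` this
asks for lengths at least `Lip(φ i) ^ α`, and `α > sdim` makes their sum less than 1, leaving time
for `γ`. -/

/-- A map on functions with values in a bounded complete space which contracts the uniform distance
has a fixed point. -/
theorem exists_fixed_of_uniform_contraction {A Y : Type*} [MetricSpace Y] [CompleteSpace Y]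
    [Nonempty Y] {D r : ℝ} (hD : ∀ x y : Y, dist x y ≤ D) (hr0 : 0 ≤ r) (hr1 : r < 1)
    (T : (A → Y) → A → Y)
    (hT : ∀ f g c, (∀ a, dist (f a) (g a) ≤ c) → ∀ a, dist (T f a) (T g a) ≤ r * c) :
    ∃ f, T f = f := by
  obtain ⟨y₀⟩ := ‹Nonempty Y›
  set F : ℕ → A → Y := fun n => T^[n] (fun _ => y₀) with hF
  have hsucc : ∀ n, F (n + 1) = T (F n) := fun n => Function.iterate_succ_apply' T n _
  have hstep : ∀ n a, dist (F n a) (F (n + 1) a) ≤ D * r ^ n := by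
    intro n
    induction n with
    | zero => intro a; simpa using hD _ _
    | succ n ih =>
      intro a
      rw [hsucc n, hsucc (n + 1)]
      refine (hT _ _ _ ih a).trans (le_of_eq ?_)
      ring
  have hc : ∀ a, ∃ y, Filter.Tendsto (fun n => F n a) Filter.atTop (nhds y) := fun a =>
    cauchySeq_tendsto_of_complete (cauchySeq_of_le_geometric r D hr1 fun n => hstep n a)
  choose f hf using hc
  have hlim : ∀ n a, dist (F n a) (f a) ≤ D * r ^ n / (1 - r) := fun n a =>
    dist_le_of_le_geometric_of_tendsto r D hr1 (fun n => hstep n a) (hf a) n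
  refine ⟨f, funext fun a => ?_⟩
  have h1 : ∀ n, dist (T f a) (F (n + 1) a) ≤ r * (D * r ^ n / (1 - r)) := by
    intro n
    rw [hsucc]
    exact hT _ _ _ (fun a => by rw [dist_comm]; exact hlim n a) a
  have h2 : Filter.Tendsto (fun n : ℕ => r * (D * r ^ n / (1 - r))) Filter.atTop (nhds 0) := by
    have := ((((tendsto_pow_atTop_nhds_zero_of_lt_one hr0 hr1).const_mul D).div_const
      (1 - r)).const_mul r)
    simpa using this
  have h3 := squeeze_zero (fun n => dist_nonneg) h1 h2
  have h4 : Filter.Tendsto (fun n => F (n + 1) a) Filter.atTop (nhds (T f a)) := by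
    rw [tendsto_iff_dist_tendsto_zero]
    simpa [dist_comm] using h3
  exact tendsto_nhds_unique h4 ((Filter.tendsto_add_atTop_iff_nat 1).2 (hf a))

/-- This removes the error term: objects defined by contracting recursions are estimated after `n`
unfoldings, with the crude bound `D` at the bottom. -/
theorem le_of_forall_le_add_pow_mul {x c r D : ℝ} (hr0 : 0 ≤ r) (hr1 : r < 1)
    (h : ∀ n : ℕ, x ≤ c + r ^ n * D) : x ≤ c := by
  have := ((tendsto_pow_atTop_nhds_zero_of_lt_one hr0 hr1).mul_const D).const_add c
  simp only [zero_mul, add_zero] at this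
  exact ge_of_tendsto' this h

/-- The contraction pays for the time compression exactly, so Hölder constants do not grow from one
level to the next. -/
theorem mul_div_rpow_le {L l u ρ : ℝ} (hl : 0 < l) (hL : L ≤ l ^ ρ) (hu : 0 ≤ u) :
    L * (u / l) ^ ρ ≤ u ^ ρ := by
  rw [Real.div_rpow hu hl.le]
  have : 0 < l ^ ρ := Real.rpow_pos_of_pos hl ρ
  calc L * (u ^ ρ / l ^ ρ) ≤ l ^ ρ * (u ^ ρ / l ^ ρ) := by
        gcongr
    _ = u ^ ρ := by field_simp

/-! ### The abstract setting: contractions, coding and the time budget. -/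

/-- The shift on infinite words. -/
def tail (w : ℕ → ℕ) : ℕ → ℕ := fun n => w (n + 1)

/-- A sequence of uniform contractions of a bounded space `Y` with a surjective coding map by
infinite words, a curve meeting the image of each of the maps, and a choice of lengths of disjoint
time intervals in which these images are to be visited. -/
structure CurveSystem (Y : Type*) [MetricSpace Y] where
  map : ℕ → Y → Y
  ratio : ℕ → ℝ
  r : ℝ
  D : ℝ
  ratio_nonneg : ∀ i, 0 ≤ ratio i
  ratio_le : ∀ i, ratio i ≤ r
  r_lt_one : r < 1
  dist_map : ∀ i x y, dist (map i x) (map i y) ≤ ratio i * dist x y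
  dist_le : ∀ x y : Y, dist x y ≤ D
  code : (ℕ → ℕ) → Y
  code_eq : ∀ w, code w = map (w 0) (code (tail w))
  code_surj : Function.Surjective code
  curve : ℝ → Y
  time : ℕ → ℝ
  time_mem : ∀ i, time i ∈ Set.Icc (0 : ℝ) 1
  word : ℕ → ℕ → ℕ
  curve_time : ∀ i, curve (time i) = map i (code (word i))
  len : ℕ → ℝ
  len_pos : ∀ i, 0 < len i
  len_summable : Summable len
  η : ℝ
  η_pos : 0 < η
  len_sum : 3 * η + ∑' i, len i ≤ 1

/-- Hölder continuity on the real line, with real exponent and constant. -/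
def HolderReal {Y : Type*} [MetricSpace Y] (C ρ : ℝ) (f : ℝ → Y) : Prop :=
  ∀ x y, dist (f x) (f y) ≤ C * |x - y| ^ ρ

theorem HolderReal.nonneg {Y : Type*} [MetricSpace Y] {C ρ : ℝ} {f : ℝ → Y}
    (h : HolderReal C ρ f) : 0 ≤ C := by
  have := dist_nonneg.trans (h 1 0)
  simpa using this

namespace CurveSystem

variable {Y : Type*} [MetricSpace Y] (S : CurveSystem Y)

theorem r_nonneg : 0 ≤ S.r := (S.ratio_nonneg 0).trans (S.ratio_le 0)

theorem D_nonneg : 0 ≤ S.D := dist_nonneg.trans (S.dist_le (S.code 0) (S.code 0))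

theorem ratio_le_one (i : ℕ) : S.ratio i ≤ 1 := (S.ratio_le i).trans S.r_lt_one.le

theorem dist_map_le {i : ℕ} {x y : Y} {c : ℝ} (h : dist x y ≤ c) :
    dist (S.map i x) (S.map i y) ≤ S.ratio i * c :=
  (S.dist_map i x y).trans (mul_le_mul_of_nonneg_left h (S.ratio_nonneg i))

theorem dist_map_le_r {i : ℕ} {x y : Y} {c : ℝ} (h : dist x y ≤ c) :
    dist (S.map i x) (S.map i y) ≤ S.r * c :=
  (S.dist_map_le h).trans
    (mul_le_mul_of_nonneg_right (S.ratio_le i) (dist_nonneg.trans h))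

/-- The step common to all inductions on depth: the main term is scaled by the map's own ratio, the
error by at most `r`. -/
theorem dist_map_le_add_pow {i n : ℕ} {x y : Y} {c e : ℝ} (h : dist x y ≤ c + S.r ^ n * S.D)
    (hc : S.ratio i * c ≤ e) :
    dist (S.map i x) (S.map i y) ≤ e + S.r ^ (n + 1) * S.D := by
  refine (S.dist_map_le h).trans ?_
  have h1 : S.ratio i * (S.r ^ n * S.D) ≤ S.r * (S.r ^ n * S.D) :=
    mul_le_mul_of_nonneg_right (S.ratio_le i)
      (mul_nonneg (pow_nonneg S.r_nonneg _) S.D_nonneg)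
  rw [mul_add, pow_succ']
  linarith

theorem dist_map_scale {i n : ℕ} {x y : Y} {C ρ l u : ℝ} (hC : 0 ≤ C) (hl : 0 < l) (hu : 0 ≤ u)
    (hL : S.ratio i ≤ l ^ ρ) (h : dist x y ≤ C * (u / l) ^ ρ + S.r ^ n * S.D) :
    dist (S.map i x) (S.map i y) ≤ C * u ^ ρ + S.r ^ (n + 1) * S.D := by
  refine S.dist_map_le_add_pow h ?_
  have := mul_le_mul_of_nonneg_left (mul_div_rpow_le hl hL hu) hC
  linarith

/-- Two terminal pieces leave at least `η` of the unit time for the passage along the curve, so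
`bridge` has slope at most `1 / η`. -/
theorem len_pair {i j : ℕ} (h : i ≠ j) : S.len i + S.len j + S.η ≤ 1 := by
  have h1 := S.len_summable.sum_le_tsum {i, j} (fun k _ => (S.len_pos k).le)
  rw [Finset.sum_pair h] at h1
  linarith [S.len_sum, S.η_pos]

/-- The affine function which is `time i` at `len i` and `time j` at `1 - len j`. -/
noncomputable def bridge (i j : ℕ) (x : ℝ) : ℝ :=
  S.time i + (S.time j - S.time i) * ((x - S.len i) / (1 - S.len i - S.len j))

theorem bridge_len (i j : ℕ) : S.bridge i j (S.len i) = S.time i := by simp [bridge]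

theorem bridge_symm {i j : ℕ} (h : i ≠ j) (x : ℝ) : S.bridge j i (1 - x) = S.bridge i j x := by
  have h1 := S.len_pair h
  have h2 := S.η_pos
  have h3 : 1 - S.len i - S.len j ≠ 0 := by intro h; linarith
  have h4 : 1 - S.len j - S.len i ≠ 0 := by intro h; linarith
  unfold bridge
  field_simp
  ring

theorem abs_bridge_sub_le {i j : ℕ} (h : i ≠ j) (x y : ℝ) :
    |S.bridge i j x - S.bridge i j y| ≤ |x - y| / S.η := by
  have h1 := S.len_pair h
  have h2 := S.η_pos
  have h3 : S.bridge i j x - S.bridge i j y =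
      (S.time j - S.time i) * ((x - y) / (1 - S.len i - S.len j)) := by
    unfold bridge; ring
  rw [h3, abs_mul, abs_div, abs_of_pos (show 0 < 1 - S.len i - S.len j by linarith)]
  have h4 : |S.time j - S.time i| ≤ 1 := by
    have := S.time_mem i; have := S.time_mem j
    simp only [Set.mem_Icc] at *
    rw [abs_le]; constructor <;> linarith
  calc _ ≤ 1 * (|x - y| / (1 - S.len i - S.len j)) := by
        gcongr
        exact div_nonneg (abs_nonneg _) (by linarith)
    _ ≤ |x - y| / S.η := by
        rw [one_mul]
        gcongr
        linarith

theorem holder_curve_comp {C ρ : ℝ} (hρ : 0 ≤ ρ) (hγ : HolderReal C ρ S.curve) {x y u : ℝ}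
    (h : |x - y| ≤ u / S.η) : dist (S.curve x) (S.curve y) ≤ C / S.η ^ ρ * u ^ ρ := by
  have hu : 0 ≤ u := by
    have := mul_nonneg ((abs_nonneg _).trans h) S.η_pos.le
    rwa [div_mul_cancel₀ _ S.η_pos.ne'] at this
  calc dist (S.curve x) (S.curve y) ≤ C * |x - y| ^ ρ := hγ x y
    _ ≤ C * (u / S.η) ^ ρ := by
        gcongr
        exact hγ.nonneg
    _ = _ := by rw [Real.div_rpow hu S.η_pos.le]; ring

/-- Time gaps of size at least `η` need no geometry: the diameter bound is enough. -/
theorem dist_le_of_η_le {ρ : ℝ} (hρ : 0 ≤ ρ) {u : ℝ} (h : S.η ≤ u) (x y : Y) :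
    dist x y ≤ S.D / S.η ^ ρ * u ^ ρ := by
  have h1 : 0 < S.η ^ ρ := Real.rpow_pos_of_pos S.η_pos ρ
  calc dist x y ≤ S.D := S.dist_le x y
    _ = S.D / S.η ^ ρ * S.η ^ ρ := by field_simp
    _ ≤ _ := by
      gcongr
      · exact div_nonneg S.D_nonneg h1.le
      · exact S.η_pos.le

theorem uniformContinuous_curve_comp (hγ : UniformContinuous S.curve) {ε : ℝ} (hε : 0 < ε) :
    ∃ δ > 0, ∀ x y u : ℝ, u < δ → |x - y| ≤ u / S.η → dist (S.curve x) (S.curve y) ≤ ε := by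
  obtain ⟨δ, hδ, h⟩ := Metric.uniformContinuous_iff.1 hγ ε hε
  refine ⟨δ * S.η, mul_pos hδ S.η_pos, fun x y u hu hxy => (h ?_).le⟩
  rw [Real.dist_eq]
  refine hxy.trans_lt ?_
  rwa [div_lt_iff₀ S.η_pos]

/-! ### Recursive arcs between coded points, and their regularity. -/

/-- A family of arcs joining the points coded by two words, which is invariant under the recursive
construction: an arc between points of different first-level pieces goes through these two pieces
and along the given curve. -/
structure IsArcFamily (P : (ℕ → ℕ) → (ℕ → ℕ) → ℝ → Y) : Prop where
  same : ∀ v w x, v 0 = w 0 → P v w x = S.map (v 0) (P (tail v) (tail w) x)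
  left : ∀ v w x, v 0 ≠ w 0 → x < S.len (v 0) →
    P v w x = S.map (v 0) (P (tail v) (S.word (v 0)) (x / S.len (v 0)))
  mid : ∀ v w x, v 0 ≠ w 0 → S.len (v 0) ≤ x → x ≤ 1 - S.len (w 0) →
    P v w x = S.curve (S.bridge (v 0) (w 0) x)
  right : ∀ v w x, v 0 ≠ w 0 → 1 - S.len (w 0) < x →
    P v w x = S.map (w 0) (P (S.word (w 0)) (tail w) ((x - (1 - S.len (w 0))) / S.len (w 0)))

/-- Each rule either applies some `map i` to another value of the family or gives a value
independent of it, so the recursion contracts by `r`. -/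
theorem exists_isArcFamily [CompleteSpace Y] : ∃ P, S.IsArcFamily P := by
  classical
  have : Nonempty Y := ⟨S.code 0⟩
  let T : ((ℕ → ℕ) × (ℕ → ℕ) × ℝ → Y) → ((ℕ → ℕ) × (ℕ → ℕ) × ℝ → Y) := fun P q =>
    if q.1 0 = q.2.1 0 then S.map (q.1 0) (P (tail q.1, tail q.2.1, q.2.2))
    else if q.2.2 < S.len (q.1 0) then
      S.map (q.1 0) (P (tail q.1, S.word (q.1 0), q.2.2 / S.len (q.1 0)))
    else if 1 - S.len (q.2.1 0) < q.2.2 then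
      S.map (q.2.1 0) (P (S.word (q.2.1 0), tail q.2.1,
        (q.2.2 - (1 - S.len (q.2.1 0))) / S.len (q.2.1 0)))
    else S.curve (S.bridge (q.1 0) (q.2.1 0) q.2.2)
  obtain ⟨P, hP⟩ := exists_fixed_of_uniform_contraction S.dist_le S.r_nonneg S.r_lt_one T (by
    intro f g c h q
    have hc : 0 ≤ c := dist_nonneg.trans (h q)
    simp only [T]
    split_ifs
    · exact S.dist_map_le_r (h _)
    · exact S.dist_map_le_r (h _)
    · exact S.dist_map_le_r (h _)
    · rw [dist_self]; exact mul_nonneg S.r_nonneg hc)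
  refine ⟨fun v w x => P (v, w, x), ?_, ?_, ?_, ?_⟩
  · intro v w x h
    conv_lhs => rw [← hP]
    simp [T, h]
  · intro v w x h h1
    conv_lhs => rw [← hP]
    simp [T, h, h1]
  · intro v w x h h1 h2
    conv_lhs => rw [← hP]
    simp [T, h, not_lt.2 h1, not_lt.2 h2]
  · intro v w x h h1
    have h2 : ¬ x < S.len (v 0) := by linarith [S.len_pair h, S.η_pos]
    conv_lhs => rw [← hP]
    simp [T, h, h1, h2]

end CurveSystem

namespace CurveSystem

namespace IsArcFamily

variable {Y : Type*} [MetricSpace Y] {S : CurveSystem Y} {P : (ℕ → ℕ) → (ℕ → ℕ) → ℝ → Y}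

/-- The rules are exchanged by swapping the words and reversing time, so both sides obey the same
contracting recursion. This later halves the case analysis. -/
theorem symm (hP : S.IsArcFamily P) (v w : ℕ → ℕ) (x : ℝ) : P w v (1 - x) = P v w x := by
  have key : ∀ n : ℕ, ∀ v w x, dist (P w v (1 - x)) (P v w x) ≤ 0 + S.r ^ n * S.D := by
    intro n
    induction n with
    | zero => intro v w x; simpa using S.dist_le _ _
    | succ n ih =>
      intro v w x
      by_cases h : v 0 = w 0
      · rw [hP.same v w x h, hP.same w v _ h.symm, h]
        exact S.dist_map_le_add_pow (ih _ _ _) (by simp)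
      have hlen := S.len_pair h
      have hη := S.η_pos
      have hl1 := S.len_pos (v 0)
      have hl2 := S.len_pos (w 0)
      rcases lt_or_ge x (S.len (v 0)) with hx | hx
      · rw [hP.left v w x h hx, hP.right w v _ (Ne.symm h) (by linarith)]
        have : (1 - x - (1 - S.len (v 0))) / S.len (v 0) = 1 - x / S.len (v 0) := by
          field_simp; ring
        rw [this]
        exact S.dist_map_le_add_pow (ih _ _ _) (by simp)
      rcases le_or_gt x (1 - S.len (w 0)) with hx' | hx'
      · rw [hP.mid v w x h hx hx', hP.mid w v _ (Ne.symm h) (by linarith) (by linarith),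
          S.bridge_symm h, dist_self]
        have := mul_nonneg (pow_nonneg S.r_nonneg (n + 1)) S.D_nonneg
        linarith
      · rw [hP.right v w x h hx', hP.left w v _ (Ne.symm h) (by linarith)]
        have : (1 - x) / S.len (w 0) = 1 - (x - (1 - S.len (w 0))) / S.len (w 0) := by
          field_simp; ring
        rw [this]
        exact S.dist_map_le_add_pow (ih _ _ _) (by simp)
  exact dist_le_zero.1 (le_of_forall_le_add_pow_mul S.r_nonneg S.r_lt_one fun n => key n v w x)

/-- Only the rules `same` and `left` apply at such times, and both peel off the first letter of `v`
exactly as `code_eq` does. -/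
theorem start (hP : S.IsArcFamily P) (v w : ℕ → ℕ) {x : ℝ} (hx : x ≤ 0) : P v w x = S.code v := by
  have key : ∀ n : ℕ, ∀ v w x, x ≤ 0 → dist (P v w x) (S.code v) ≤ 0 + S.r ^ n * S.D := by
    intro n
    induction n with
    | zero => intro v w x _; simpa using S.dist_le _ _
    | succ n ih =>
      intro v w x hx
      have hl1 := S.len_pos (v 0)
      rw [S.code_eq v]
      by_cases h : v 0 = w 0
      · rw [hP.same v w x h]
        exact S.dist_map_le_add_pow (ih _ _ _ hx) (by simp)
      · rw [hP.left v w x h (by linarith)]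
        exact S.dist_map_le_add_pow (ih _ _ _ (div_nonpos_of_nonpos_of_nonneg hx hl1.le)) (by simp)
  exact dist_le_zero.1 (le_of_forall_le_add_pow_mul S.r_nonneg S.r_lt_one fun n => key n v w x hx)

theorem finish (hP : S.IsArcFamily P) (v w : ℕ → ℕ) {x : ℝ} (hx : 1 ≤ x) :
    P v w x = S.code w := by
  rw [← hP.symm v w x]
  exact hP.start w v (by linarith)

/-- Here `δ` may depend on the depth and on the words, so splitting `ε` at a junction at every level
is harmless. -/
theorem uniformContinuous (hP : S.IsArcFamily P) (hγ : UniformContinuous S.curve) (v w : ℕ → ℕ) :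
    UniformContinuous (P v w) := by
  have key : ∀ n : ℕ, ∀ v w, ∀ ε > 0, ∃ δ > 0, ∀ x y, x ≤ y → y - x < δ →
      dist (P v w x) (P v w y) ≤ ε + S.r ^ n * S.D := by
    intro n
    induction n with
    | zero => exact fun v w ε hε => ⟨1, one_pos, fun x y _ _ => by
        simpa using (S.dist_le _ _).trans (by linarith)⟩
    | succ n ih =>
      intro v w ε hε
      by_cases h : v 0 = w 0
      · obtain ⟨δ, hδ, H⟩ := ih (tail v) (tail w) ε hε
        refine ⟨δ, hδ, fun x y hxy hd => ?_⟩
        rw [hP.same v w x h, hP.same v w y h]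
        refine S.dist_map_le_add_pow (H x y hxy hd) ?_
        nlinarith [S.ratio_le_one (v 0)]
      have first : ∀ v w : ℕ → ℕ, v 0 ≠ w 0 → ∃ δ > 0, ∀ x y, x ≤ y → y - x < δ →
          x < S.len (v 0) → dist (P v w x) (P v w y) ≤ ε + S.r ^ (n + 1) * S.D := by
        intro v w h
        have hlen := S.len_pair h
        have hη := S.η_pos
        have hl1 := S.len_pos (v 0)
        obtain ⟨δ₁, hδ₁, H₁⟩ := ih (tail v) (S.word (v 0)) (ε / 2) (half_pos hε)
        obtain ⟨δ₂, hδ₂, H₂⟩ := S.uniformContinuous_curve_comp hγ (half_pos hε)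
        have hratio : S.ratio (v 0) * (ε / 2) ≤ ε / 2 := by
          nlinarith [S.ratio_le_one (v 0)]
        -- The first piece is run at time scale `len (v 0)`, whence the first bound; a gap below `η`
        -- keeps `y` out of the last piece.
        refine ⟨min (δ₁ * S.len (v 0)) (min δ₂ S.η), by positivity, fun x y hxy hd hx => ?_⟩
        simp only [lt_min_iff] at hd
        obtain ⟨hd1, hd2, hd3⟩ := hd
        rcases lt_or_ge y (S.len (v 0)) with hy | hy
        · rw [hP.left v w x h hx, hP.left v w y h hy]
          refine S.dist_map_le_add_pow (H₁ _ _ (by gcongr) ?_) (by linarith)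
          rwa [← sub_div, div_lt_iff₀ hl1]
        · rw [hP.mid v w y h hy (by linarith)]
          have h1 : dist (P v w x) (S.curve (S.time (v 0))) ≤ ε / 2 + S.r ^ (n + 1) * S.D := by
            rw [hP.left v w x h hx, S.curve_time, ← hP.finish (tail v) (S.word (v 0)) le_rfl]
            refine S.dist_map_le_add_pow (H₁ _ _ ((div_le_one hl1).2 hx.le) ?_) hratio
            rw [sub_lt_iff_lt_add, ← sub_lt_iff_lt_add', lt_div_iff₀ hl1]
            linarith
          have h2 : dist (S.curve (S.time (v 0))) (S.curve (S.bridge (v 0) (w 0) y)) ≤ ε / 2 := by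
            rw [← S.bridge_len (v 0) (w 0)]
            refine H₂ _ _ (y - S.len (v 0)) (by linarith) ?_
            refine (S.abs_bridge_sub_le h _ _).trans (le_of_eq ?_)
            rw [abs_sub_comm, abs_of_nonneg (by linarith)]
          linarith [dist_triangle (P v w x) (S.curve (S.time (v 0)))
            (S.curve (S.bridge (v 0) (w 0) y))]
      have hη := S.η_pos
      obtain ⟨δ₁, hδ₁, H₁⟩ := first v w h
      obtain ⟨δ₂, hδ₂, H₂⟩ := first w v (Ne.symm h)
      obtain ⟨δ₃, hδ₃, H₃⟩ := S.uniformContinuous_curve_comp hγ hε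
      refine ⟨min δ₁ (min δ₂ δ₃), by positivity, fun x y hxy hd => ?_⟩
      simp only [lt_min_iff] at hd
      obtain ⟨hd1, hd2, hd3⟩ := hd
      rcases lt_or_ge x (S.len (v 0)) with hx | hx
      · exact H₁ x y hxy hd1 hx
      rcases lt_or_ge (1 - S.len (w 0)) y with hy | hy
      · rw [dist_comm, ← hP.symm v w, ← hP.symm v w]
        exact H₂ (1 - y) (1 - x) (by linarith) (by linarith) (by linarith)
      · rw [hP.mid v w x h hx (by linarith), hP.mid v w y h (by linarith) hy]
        have h1 := H₃ _ _ _ hd3 ((S.abs_bridge_sub_le h x y).trans (le_of_eq (by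
          rw [abs_sub_comm, abs_of_nonneg (by linarith)])))
        linarith [mul_nonneg (pow_nonneg S.r_nonneg (n + 1)) S.D_nonneg]
  refine Metric.uniformContinuous_iff.2 fun ε hε => ?_
  obtain ⟨n, hn⟩ : ∃ n : ℕ, S.r ^ n * S.D < ε / 2 := by
    have := (tendsto_pow_atTop_nhds_zero_of_lt_one S.r_nonneg S.r_lt_one).mul_const S.D
    rw [zero_mul] at this
    exact (this.eventually (gt_mem_nhds (half_pos hε))).exists
  obtain ⟨δ, hδ, H⟩ := key n v w (ε / 2) (half_pos hε)
  refine ⟨δ, hδ, fun a b hab => ?_⟩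
  rw [Real.dist_eq, abs_lt] at hab
  rcases le_total a b with hle | hle
  · linarith [H a b hle (by linarith)]
  · rw [dist_comm]
    linarith [H b a hle (by linarith)]

/-- Regularity at an endpoint alone survives the recursion with a fixed constant: inside the first
piece it rescales without loss, on the bridge it follows from the curve and the diameter of the
piece, and in the last piece `x ≥ η`. -/
theorem dist_start_le (hP : S.IsArcFamily P) {C ρ : ℝ} (hρ : 0 ≤ ρ) (hγ : HolderReal C ρ S.curve)
    (hlen : ∀ i, S.ratio i ≤ S.len i ^ ρ) (v w : ℕ → ℕ) {x : ℝ} (hx : 0 ≤ x) :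
    dist (P v w x) (S.code v) ≤ (C / S.η ^ ρ + S.D + S.D / S.η ^ ρ) * x ^ ρ := by
  have hη := S.η_pos
  have hηρ : 0 < S.η ^ ρ := Real.rpow_pos_of_pos hη ρ
  have hD := S.D_nonneg
  have hC := hγ.nonneg
  have key : ∀ n : ℕ, ∀ v w x, 0 ≤ x → dist (P v w x) (S.code v) ≤
      (C / S.η ^ ρ + S.D + S.D / S.η ^ ρ) * x ^ ρ + S.r ^ n * S.D := by
    intro n
    induction n with
    | zero =>
      intro v w x hx
      have : 0 ≤ (C / S.η ^ ρ + S.D + S.D / S.η ^ ρ) * x ^ ρ := by positivity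
      simpa using (S.dist_le _ _).trans (by linarith)
    | succ n ih =>
      intro v w x hx
      have hrn := mul_nonneg (pow_nonneg S.r_nonneg (n + 1)) S.D_nonneg
      have hl1 := S.len_pos (v 0)
      have hxρ : 0 ≤ x ^ ρ := Real.rpow_nonneg hx ρ
      by_cases h : v 0 = w 0
      · rw [S.code_eq v, hP.same v w x h]
        refine S.dist_map_le_add_pow (ih _ _ _ hx) ?_
        exact mul_le_of_le_one_left (by positivity) (S.ratio_le_one _)
      have hl := S.len_pair h
      have hl2 := S.len_pos (w 0)
      rcases lt_or_ge x (S.len (v 0)) with hx1 | hx1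
      · rw [S.code_eq v, hP.left v w x h hx1]
        exact S.dist_map_scale (by positivity) hl1 hx (hlen _) (ih _ _ _ (by positivity))
      rcases le_or_gt x (1 - S.len (w 0)) with hx2 | hx2
      · rw [hP.mid v w x h hx1 hx2]
        have h1 : dist (S.curve (S.bridge (v 0) (w 0) x)) (S.curve (S.time (v 0))) ≤
            C / S.η ^ ρ * x ^ ρ := by
          rw [← S.bridge_len (v 0) (w 0)]
          refine S.holder_curve_comp hρ hγ ((S.abs_bridge_sub_le h _ _).trans ?_)
          gcongr
          rw [abs_of_nonneg (by linarith)]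
          linarith
        have h2 : dist (S.curve (S.time (v 0))) (S.code v) ≤ S.D * x ^ ρ := by
          rw [S.curve_time, S.code_eq v]
          refine (S.dist_map_le (S.dist_le _ _)).trans ?_
          rw [mul_comm]
          gcongr
          -- On the bridge `x ≥ len (v 0)`, so the first piece has diameter at most `D * x ^ ρ`.
          exact (hlen _).trans (by gcongr)
        have h3 : 0 ≤ S.D / S.η ^ ρ * x ^ ρ := by positivity
        rw [add_mul, add_mul]
        linarith [dist_triangle (S.curve (S.bridge (v 0) (w 0) x)) (S.curve (S.time (v 0)))
          (S.code v)]
      · have h1 := S.dist_le_of_η_le hρ (show S.η ≤ x by linarith) (P v w x) (S.code v)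
        have h2 : 0 ≤ (C / S.η ^ ρ + S.D) * x ^ ρ := by positivity
        rw [add_mul]
        linarith
  exact le_of_forall_le_add_pow_mul S.r_nonneg S.r_lt_one fun n => key n v w x hx

/-- The induction hypothesis is used only when both times lie in the same piece or the first letters
agree, where it costs nothing; distances to a junction come from `dist_start_le`. The constant is
thus independent of depth and words. -/
theorem holder (hP : S.IsArcFamily P) {C ρ : ℝ} (hρ : 0 ≤ ρ) (hγ : HolderReal C ρ S.curve)
    (hlen : ∀ i, S.ratio i ≤ S.len i ^ ρ) (v w : ℕ → ℕ) :
    HolderReal (C / S.η ^ ρ + S.D + S.D / S.η ^ ρ + C / S.η ^ ρ) ρ (P v w) := by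
  have hη := S.η_pos
  have hηρ : 0 < S.η ^ ρ := Real.rpow_pos_of_pos hη ρ
  have hD := S.D_nonneg
  have hC := hγ.nonneg
  have hE : 0 ≤ C / S.η ^ ρ + S.D + S.D / S.η ^ ρ := by positivity
  have hE' : 0 ≤ C / S.η ^ ρ := by positivity
  set E := C / S.η ^ ρ + S.D + S.D / S.η ^ ρ with hEdef
  have hDE : S.D / S.η ^ ρ ≤ E := by
    have : 0 ≤ C / S.η ^ ρ + S.D := by positivity
    linarith
  have key : ∀ n : ℕ, ∀ v w x y, x ≤ y → dist (P v w x) (P v w y) ≤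
      (E + C / S.η ^ ρ) * (y - x) ^ ρ + S.r ^ n * S.D := by
    intro n
    induction n with
    | zero =>
      intro v w x y hxy
      have : 0 ≤ (E + C / S.η ^ ρ) * (y - x) ^ ρ :=
        mul_nonneg (by positivity) (Real.rpow_nonneg (by linarith) _)
      simpa using (S.dist_le _ _).trans (by linarith)
    | succ n ih =>
      intro v w x y hxy
      have hrn := mul_nonneg (pow_nonneg S.r_nonneg (n + 1)) S.D_nonneg
      have hu : 0 ≤ (y - x) ^ ρ := Real.rpow_nonneg (by linarith) _
      by_cases h : v 0 = w 0
      · rw [hP.same v w x h, hP.same v w y h]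
        refine S.dist_map_le_add_pow (ih _ _ _ _ hxy) ?_
        exact mul_le_of_le_one_left (by positivity) (S.ratio_le_one _)
      have first : ∀ v w : ℕ → ℕ, v 0 ≠ w 0 → ∀ x y, x ≤ y → x < S.len (v 0) →
          dist (P v w x) (P v w y) ≤
            (E + C / S.η ^ ρ) * (y - x) ^ ρ + S.r ^ (n + 1) * S.D := by
        intro v w h x y hxy hx
        have hl := S.len_pair h
        have hl1 := S.len_pos (v 0)
        have hu : 0 ≤ (y - x) ^ ρ := Real.rpow_nonneg (by linarith) _
        rcases lt_or_ge y (S.len (v 0)) with hy | hy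
        · rw [hP.left v w x h hx, hP.left v w y h hy]
          refine S.dist_map_scale (by positivity) hl1 (by linarith) (hlen _) ?_
          rw [sub_div]
          exact ih _ _ _ _ (by gcongr)
        rcases le_or_gt y (1 - S.len (w 0)) with hy2 | hy2
        · rw [hP.mid v w y h hy hy2]
          have h1 : dist (P v w x) (S.curve (S.time (v 0))) ≤ E * (y - x) ^ ρ := by
            -- Reversal turns the junction into the start of an arc.
            rw [hP.left v w x h hx, S.curve_time, ← hP.symm]
            have hx1 : 0 ≤ 1 - x / S.len (v 0) := by
              rw [sub_nonneg, div_le_one hl1]; exact hx.le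
            refine (S.dist_map_le (hP.dist_start_le hρ hγ hlen _ _ hx1)).trans ?_
            rw [← hEdef]
            have h2 : 1 - x / S.len (v 0) = (S.len (v 0) - x) / S.len (v 0) := by field_simp
            have h3 := mul_div_rpow_le hl1 (hlen (v 0)) (show 0 ≤ S.len (v 0) - x by linarith)
            have h4 : (S.len (v 0) - x) ^ ρ ≤ (y - x) ^ ρ :=
              Real.rpow_le_rpow (by linarith) (by linarith) hρ
            rw [h2]
            have := mul_le_mul_of_nonneg_left (h3.trans h4) hE
            linarith
          have h2 : dist (S.curve (S.time (v 0))) (S.curve (S.bridge (v 0) (w 0) y)) ≤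
              C / S.η ^ ρ * (y - x) ^ ρ := by
            rw [← S.bridge_len (v 0) (w 0)]
            refine S.holder_curve_comp hρ hγ ((S.abs_bridge_sub_le h _ _).trans ?_)
            gcongr
            rw [abs_sub_comm, abs_of_nonneg (by linarith)]
            linarith
          rw [add_mul]
          linarith [dist_triangle (P v w x) (S.curve (S.time (v 0)))
            (S.curve (S.bridge (v 0) (w 0) y))]
        · have h1 := S.dist_le_of_η_le hρ (show S.η ≤ y - x by linarith) (P v w x) (P v w y)
          have h2 := mul_le_mul_of_nonneg_right hDE hu
          have h3 := mul_nonneg hE' hu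
          rw [add_mul]
          linarith
      rcases lt_or_ge x (S.len (v 0)) with hx | hx
      · exact first v w h x y hxy hx
      rcases lt_or_ge (1 - S.len (w 0)) y with hy | hy
      · rw [dist_comm, ← hP.symm v w, ← hP.symm v w]
        have := first w v (Ne.symm h) (1 - y) (1 - x) (by linarith) (by linarith)
        rwa [show 1 - x - (1 - y) = y - x by ring] at this
      · rw [hP.mid v w x h hx (by linarith), hP.mid v w y h (by linarith) hy]
        have h1 : dist (S.curve (S.bridge (v 0) (w 0) x)) (S.curve (S.bridge (v 0) (w 0) y)) ≤
            C / S.η ^ ρ * (y - x) ^ ρ := by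
          refine S.holder_curve_comp hρ hγ ((S.abs_bridge_sub_le h _ _).trans ?_)
          gcongr
          rw [abs_sub_comm, abs_of_nonneg (by linarith)]
        have h2 := mul_nonneg hE hu
        rw [add_mul]
        linarith
  intro x y
  rcases le_total x y with hle | hle
  · rw [abs_sub_comm, abs_of_nonneg (by linarith)]
    exact le_of_forall_le_add_pow_mul S.r_nonneg S.r_lt_one fun n => key n v w x y hle
  · rw [dist_comm, abs_of_nonneg (by linarith)]
    exact le_of_forall_le_add_pow_mul S.r_nonneg S.r_lt_one fun n => key n v w y x hle

end IsArcFamily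

end CurveSystem

/-! ### Gluing curves along disjoint intervals. -/

/-- The open intervals `(a i, a i + l i)` are pairwise disjoint. -/
def IsPacking (a l : ℕ → ℝ) : Prop :=
  ∀ i j, i ≠ j → a i + l i ≤ a j ∨ a j + l j ≤ a i

theorem IsPacking.eq {a l : ℕ → ℝ} (h : IsPacking a l) {i j : ℕ} {x : ℝ}
    (hi : x ∈ Set.Ioo (a i) (a i + l i)) (hj : x ∈ Set.Ioo (a j) (a j + l j)) : i = j := by
  by_contra hne
  rcases h i j hne with h1 | h1 <;> linarith [hi.1, hi.2, hj.1, hj.2]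

open Classical in
/-- The function which is `piece i` on the `i`-th interval and `G` off these intervals. -/
noncomputable def glue {Y : Type*} (a l : ℕ → ℝ) (piece : ℕ → ℝ → Y) (G : ℝ → Y) (x : ℝ) : Y :=
  if h : ∃ i, x ∈ Set.Ioo (a i) (a i + l i) then piece h.choose x else G x

theorem glue_of_mem {Y : Type*} {a l : ℕ → ℝ} (hp : IsPacking a l) (piece : ℕ → ℝ → Y) (G : ℝ → Y) {i : ℕ}
    {x : ℝ} (hx : x ∈ Set.Ioo (a i) (a i + l i)) : glue a l piece G x = piece i x := by
  have h : ∃ i, x ∈ Set.Ioo (a i) (a i + l i) := ⟨i, hx⟩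
  rw [glue, dif_pos h, hp.eq h.choose_spec hx]

theorem glue_of_notMem {Y : Type*} {a l : ℕ → ℝ} (piece : ℕ → ℝ → Y) (G : ℝ → Y)
    {x : ℝ} (hx : ∀ i, x ∉ Set.Ioo (a i) (a i + l i)) : glue a l piece G x = G x := by
  rw [glue, dif_neg (by simpa using hx)]

/-- Unless both times share an interval, one passes from `F` to `G` at each of them; the deviation
is charged only to times whose interval the other time has left. -/
theorem dist_glue_le {Y : Type*} [MetricSpace Y] {a l : ℕ → ℝ} {F G : ℝ → Y}
    (hFG : ∀ x, (∀ i, x ∉ Set.Ioo (a i) (a i + l i)) → F x = G x) {x y c₁ c₂ : ℝ} (hc₂ : 0 ≤ c₂)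
    (h₁ : dist (G x) (G y) ≤ c₁)
    (hx : ∀ i, x ∈ Set.Ioo (a i) (a i + l i) → y ∉ Set.Ioo (a i) (a i + l i) →
      dist (F x) (G x) ≤ c₂)
    (hy : ∀ i, y ∈ Set.Ioo (a i) (a i + l i) → x ∉ Set.Ioo (a i) (a i + l i) →
      dist (F y) (G y) ≤ c₂)
    (h₂ : ∀ i, x ∈ Set.Ioo (a i) (a i + l i) → y ∈ Set.Ioo (a i) (a i + l i) →
      dist (F x) (F y) ≤ c₁ + 2 * c₂) :
    dist (F x) (F y) ≤ c₁ + 2 * c₂ := by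
  by_cases hxy : ∃ i, x ∈ Set.Ioo (a i) (a i + l i) ∧ y ∈ Set.Ioo (a i) (a i + l i)
  · obtain ⟨i, h1, h2⟩ := hxy
    exact h₂ i h1 h2
  · push Not at hxy
    have h3 : dist (F x) (G x) ≤ c₂ := by
      by_cases h : ∃ i, x ∈ Set.Ioo (a i) (a i + l i)
      · obtain ⟨i, hi⟩ := h
        exact hx i hi (hxy i hi)
      · push Not at h
        rwa [hFG x h, dist_self]
    have h4 : dist (F y) (G y) ≤ c₂ := by
      by_cases h : ∃ i, y ∈ Set.Ioo (a i) (a i + l i)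
      · obtain ⟨i, hi⟩ := h
        exact hy i hi fun h' => hxy i h' hi
      · push Not at h
        rwa [hFG y h, dist_self]
    have h5 := dist_triangle4 (F x) (G x) (G y) (F y)
    rw [dist_comm (G y)] at h5
    linarith

theorem exists_endpoint_abs_sub_le {a b x y : ℝ} (hx : x ∈ Set.Ioo a b) (hy : y ∉ Set.Ioo a b) :
    ∃ e, (e = a ∨ e = b) ∧ |x - e| ≤ |x - y| := by
  obtain ⟨h1, h2⟩ := hx
  by_cases h : y ≤ a
  · refine ⟨a, Or.inl rfl, ?_⟩
    rw [abs_of_nonneg (by linarith), abs_of_nonneg (by linarith)]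
    linarith
  · have : b ≤ y := by
      by_contra h'
      exact hy ⟨not_le.1 h, not_le.1 h'⟩
    refine ⟨b, Or.inr rfl, ?_⟩
    rw [abs_sub_comm, abs_of_nonneg (by linarith), abs_sub_comm, abs_of_nonneg (by linarith)]
    linarith

theorem exists_pos_forall_lt {p : ℕ → ℝ → Prop} (hp : ∀ i δ δ', δ' ≤ δ → p i δ → p i δ')
    (h : ∀ i, ∃ δ > 0, p i δ) (N : ℕ) : ∃ δ > 0, ∀ i < N, p i δ := by
  induction N with
  | zero => exact ⟨1, one_pos, by simp⟩
  | succ N ih =>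
    obtain ⟨δ₁, h₁, H₁⟩ := ih
    obtain ⟨δ₂, h₂, H₂⟩ := h N
    refine ⟨min δ₁ δ₂, lt_min h₁ h₂, fun i hi => ?_⟩
    rcases Nat.lt_succ_iff_lt_or_eq.1 hi with hi | rfl
    · exact hp _ _ _ (min_le_left _ _) (H₁ i hi)
    · exact hp _ _ _ (min_le_right _ _) H₂

/-! ### Uniformity over all maps, and placement of the time intervals. -/

namespace CurveSystem

variable {Y : Type*} [MetricSpace Y] (S : CurveSystem Y)

/-- Estimates which hold for each index are uniform in the index after applying the maps. -/
theorem exists_uniform_delta (hr : Filter.Tendsto S.ratio Filter.atTop (nhds 0)) {κ : Type*}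
    (m : ℕ → κ → ℝ) (q q' : ℕ → κ → Y) {e : ℝ} (he : 0 ≤ e)
    (h : ∀ i, ∀ ε > 0, ∃ δ > 0, ∀ k, m i k < δ → dist (q i k) (q' i k) ≤ ε + e) {ε : ℝ}
    (hε : 0 < ε) :
    ∃ δ > 0, ∀ i k, m i k < δ → dist (S.map i (q i k)) (S.map i (q' i k)) ≤ ε + S.r * e := by
  have h1 : Filter.Tendsto (fun i => S.ratio i * S.D) Filter.atTop (nhds 0) := by
    simpa using hr.mul_const S.D
  -- From `N` on, the images have diameter below `ε` and nothing is needed; finitely many indices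
  -- remain.
  obtain ⟨N, hN⟩ := Filter.eventually_atTop.1 (h1.eventually (gt_mem_nhds hε))
  obtain ⟨δ, hδ, H⟩ := exists_pos_forall_lt
    (p := fun i δ => ∀ k, m i k < δ → dist (q i k) (q' i k) ≤ ε + e)
    (fun i δ δ' hle hp k hk => hp k (hk.trans_le hle)) (fun i => h i ε hε) N
  refine ⟨δ, hδ, fun i k hk => ?_⟩
  have hre := mul_nonneg S.r_nonneg he
  rcases lt_or_ge i N with hi | hi
  · refine (S.dist_map_le (H i hi k hk)).trans ?_
    rw [mul_add]
    exact add_le_add (mul_le_of_le_one_left hε.le (S.ratio_le_one i))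
      (mul_le_mul_of_nonneg_right (S.ratio_le i) he)
  · have := S.dist_map_le (i := i) (S.dist_le (q i k) (q' i k))
    linarith [hN i hi]

/-- The order in which the time intervals are placed. -/
def Prec (i j : ℕ) : Prop := S.time i < S.time j ∨ (S.time i = S.time j ∧ i < j)

open Classical in
/-- The total length of the time intervals placed before the `i`-th one. -/
noncomputable def lenBefore (i : ℕ) : ℝ := ∑' j, if S.Prec j i then S.len j else 0

theorem lenBefore_nonneg (i : ℕ) : 0 ≤ S.lenBefore i :=
  tsum_nonneg fun j => by split_ifs <;> simp [(S.len_pos j).le]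

/-- The majorant `g` is free so as to serve twice: with all lengths, and with the lengths placed
before a later index. -/
theorem lenBefore_add_len_le (i : ℕ) {g : ℕ → ℝ} (hg : Summable g) (hg0 : ∀ j, 0 ≤ g j)
    (hi : S.len i ≤ g i) (h : ∀ j, S.Prec j i → S.len j ≤ g j) :
    S.lenBefore i + S.len i ≤ ∑' j, g j := by
  classical
  have h1 : Summable fun j => if S.Prec j i then S.len j else 0 :=
    Summable.of_nonneg_of_le (fun j => by split_ifs <;> simp [(S.len_pos j).le])
      (fun j => by split_ifs <;> simp [(S.len_pos j).le]) S.len_summable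
  have h2 : HasSum (fun j => if j = i then S.len i else 0) (S.len i) := hasSum_ite_eq i (S.len i)
  rw [lenBefore, ← h2.tsum_eq, ← h1.tsum_add h2.summable]
  refine (h1.add h2.summable).tsum_le_tsum (fun j => ?_) hg
  by_cases hji : j = i
  · subst hji
    simpa [Prec] using hi
  · simp only [hji, if_false, add_zero]
    split_ifs with hp
    · exact h j hp
    · exact hg0 j

theorem lenBefore_add_len_le_of_prec {i j : ℕ} (h : S.Prec i j) :
    S.lenBefore i + S.len i ≤ S.lenBefore j := by
  classical
  have h0 : ∀ k, 0 ≤ if S.Prec k j then S.len k else 0 := fun k => by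
    split_ifs <;> simp [(S.len_pos k).le]
  refine S.lenBefore_add_len_le i ?_ h0 (by simp [h]) fun k hk => ?_
  · exact Summable.of_nonneg_of_le h0
      (fun j => by split_ifs <;> simp [(S.len_pos j).le]) S.len_summable
  · have : S.Prec k j := by
      unfold Prec at *
      rcases h with h | h <;> rcases hk with hk | hk
      · exact Or.inl (hk.trans h)
      · exact Or.inl (hk.1 ▸ h)
      · exact Or.inl (h.1 ▸ hk)
      · exact Or.inr ⟨hk.1.trans h.1, hk.2.trans h.2⟩
    simp [this]

theorem prec_or_prec {i j : ℕ} (h : i ≠ j) : S.Prec i j ∨ S.Prec j i := by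
  unfold Prec
  rcases lt_trichotomy (S.time i) (S.time j) with h1 | h1 | h1
  · exact Or.inl (Or.inl h1)
  · rcases lt_or_gt_of_ne h with h2 | h2
    · exact Or.inl (Or.inr ⟨h1, h2⟩)
    · exact Or.inr (Or.inr ⟨h1.symm, h2⟩)
  · exact Or.inr (Or.inl h1)

/-- The left endpoint of the `i`-th time interval. -/
noncomputable def left (i : ℕ) : ℝ := S.η * (1 + S.time i) + S.lenBefore i

theorem le_left (i : ℕ) : S.η ≤ S.left i := by
  have h1 := mul_nonneg S.η_pos.le (S.time_mem i).1
  have h2 := S.lenBefore_nonneg i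
  unfold left
  linarith

/-- The budget `3 * η` is spent as a margin `η` on the left, at most `η * time i ≤ η` for running
along the curve, and a margin `η` on the right. -/
theorem left_add_len_le (i : ℕ) : S.left i + S.len i ≤ 1 - S.η := by
  have h1 := mul_le_mul_of_nonneg_left (S.time_mem i).2 S.η_pos.le
  have h2 := S.lenBefore_add_len_le i S.len_summable (fun j => (S.len_pos j).le) le_rfl
    fun j _ => le_rfl
  unfold left
  linarith [S.len_sum]

/-- The gap `η * |time i - time j|` lets the curve be followed between two stops at speed at most `1
/ η`. Stops may accumulate anywhere, so positions are sums over all predecessors. -/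
theorem left_add_len_le_of_prec {i j : ℕ} (h : S.Prec i j) :
    S.left i + S.len i + S.η * |S.time i - S.time j| ≤ S.left j := by
  have h1 := S.lenBefore_add_len_le_of_prec h
  have h2 : S.time i ≤ S.time j := by
    rcases h with h | h
    exacts [h.le, h.1.le]
  rw [abs_sub_comm, abs_of_nonneg (by linarith)]
  unfold left
  linarith

theorem isPacking_left : IsPacking S.left S.len := by
  intro i j h
  have hpos := mul_nonneg S.η_pos.le (abs_nonneg (S.time i - S.time j))
  have hpos' := mul_nonneg S.η_pos.le (abs_nonneg (S.time j - S.time i))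
  rcases S.prec_or_prec h with h1 | h1
  · exact Or.inl (by linarith [S.left_add_len_le_of_prec h1])
  · exact Or.inr (by linarith [S.left_add_len_le_of_prec h1])

theorem abs_time_sub_le {i j : ℕ} {x y : ℝ} (hx : x ∈ Set.Icc (S.left i) (S.left i + S.len i))
    (hy : y ∈ Set.Icc (S.left j) (S.left j + S.len j)) :
    |S.time i - S.time j| ≤ |x - y| / S.η := by
  rw [le_div_iff₀ S.η_pos]
  by_cases hij : i = j
  · simp [hij]
  rcases S.prec_or_prec hij with h | h
  · have := S.left_add_len_le_of_prec h
    rw [abs_sub_comm x]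
    exact le_trans (by linarith [hx.2, hy.1]) (le_abs_self (y - x))
  · have := S.left_add_len_le_of_prec h
    rw [abs_sub_comm]
    exact le_trans (by linarith [hx.1, hy.2]) (le_abs_self (x - y))

/-- A Lipschitz change of time which stops at `time i` during the `i`-th time interval. -/
theorem exists_time_change : ∃ h : ℝ → ℝ,
    (∀ i, ∀ x ∈ Set.Icc (S.left i) (S.left i + S.len i), h x = S.time i) ∧
    (∀ x ≤ 0, h x = 0) ∧ (∀ x, 1 ≤ x → h x = 0) ∧ ∀ x y, |h x - h y| ≤ |x - y| / S.η := by
  classical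
  have hη := S.η_pos
  let h₀ : ℝ → ℝ := fun x =>
    if h : ∃ i, x ∈ Set.Icc (S.left i) (S.left i + S.len i) then S.time h.choose else 0
  have hmem : ∀ i, ∀ x ∈ Set.Icc (S.left i) (S.left i + S.len i), h₀ x = S.time i := by
    intro i x hx
    have h : ∃ i, x ∈ Set.Icc (S.left i) (S.left i + S.len i) := ⟨i, hx⟩
    have h1 := S.abs_time_sub_le h.choose_spec hx
    simp only [sub_self, abs_zero, zero_div] at h1
    simp only [h₀, dif_pos h]
    exact sub_eq_zero.1 (abs_nonpos_iff.1 h1)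
  have hout : ∀ x, x ≤ 0 ∨ 1 ≤ x → h₀ x = 0 := by
    intro x hx
    have : ¬ ∃ i, x ∈ Set.Icc (S.left i) (S.left i + S.len i) := by
      rintro ⟨i, hi1, hi2⟩
      have := S.le_left i
      have := S.left_add_len_le i
      rcases hx with hx | hx <;> linarith
    simp only [h₀, dif_neg this]
  let s : Set ℝ := {x | (∃ i, x ∈ Set.Icc (S.left i) (S.left i + S.len i)) ∨ x ≤ 0 ∨ 1 ≤ x}
  have mixed : ∀ i, ∀ x ∈ Set.Icc (S.left i) (S.left i + S.len i), ∀ y, y ≤ 0 ∨ 1 ≤ y →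
      |S.time i - 0| ≤ |x - y| / S.η := by
    intro i x hx y hy
    have h1 := S.le_left i
    have h2 := S.left_add_len_le i
    have h3 := S.time_mem i
    rw [sub_zero, abs_of_nonneg h3.1]
    refine h3.2.trans ?_
    rw [one_le_div hη]
    rcases hy with hy | hy
    · exact le_trans (by linarith [hx.1]) (le_abs_self _)
    · rw [abs_sub_comm]
      exact le_trans (by linarith [hx.2]) (le_abs_self _)
  have hlip : LipschitzOnWith (Real.toNNReal (1 / S.η)) h₀ s := by
    refine LipschitzOnWith.of_dist_le_mul fun x hx y hy => ?_
    rw [Real.coe_toNNReal _ (by positivity), Real.dist_eq, Real.dist_eq, one_div_mul_eq_div]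
    rcases hx with ⟨i, hi⟩ | hx <;> rcases hy with ⟨j, hj⟩ | hy
    · rw [hmem i x hi, hmem j y hj]
      exact S.abs_time_sub_le hi hj
    · rw [hmem i x hi, hout y hy]
      exact mixed i x hi y hy
    · rw [hmem j y hj, hout x hx, abs_sub_comm, abs_sub_comm x]
      exact mixed j y hj x hx
    · rw [hout x hx, hout y hy]
      simp only [sub_self, abs_zero]
      positivity
  -- The values on the stops and outside the unit interval are `1 / η`-Lipschitz, the margins
  -- allowing the return to 0; a Lipschitz extension fills the gaps.
  obtain ⟨h, hh, heq⟩ := hlip.extend_real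
  refine ⟨h, fun i x hx => ?_, fun x hx => ?_, fun x hx => ?_, fun x y => ?_⟩
  · rw [← heq (Or.inl ⟨i, hx⟩), hmem i x hx]
  · rw [← heq (Or.inr (Or.inl hx)), hout x (Or.inl hx)]
  · rw [← heq (Or.inr (Or.inr hx)), hout x (Or.inr hx)]
  · have := hh.dist_le_mul x y
    rwa [Real.coe_toNNReal _ (by positivity), Real.dist_eq, Real.dist_eq,
      one_div_mul_eq_div] at this

theorem abs_tent_sub_le (a b x y : ℝ) :
    |min (x - a) (b - x) - min (y - a) (b - y)| ≤ |x - y| := by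
  refine (abs_min_sub_min_le_max _ _ _ _).trans (max_le (le_of_eq ?_) (le_of_eq ?_))
  · congr 1; ring
  · rw [abs_sub_comm]; congr 1; ring

/-! ### The dwelling curve. -/

/-- A closed curve which stays for some time at the image of its base point by each of the maps. -/
theorem exists_dwelling_curve [CompleteSpace Y]
    (hr : Filter.Tendsto S.ratio Filter.atTop (nhds 0)) {θ : ℝ} (hθ : 0 < θ) :
    ∃ (a : ℕ → ℝ) (Γ : ℝ → Y), (∀ i, S.η ≤ a i) ∧
      (∀ i, a i + (1 - 2 * θ) * S.len i ≤ 1 - S.η) ∧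
      IsPacking a (fun i => (1 - 2 * θ) * S.len i) ∧
      (∀ i, ∀ x ∈ Set.Icc (a i) (a i + (1 - 2 * θ) * S.len i), Γ x = S.map i (S.curve 0)) ∧
      Γ 0 = S.curve 0 ∧ Γ 1 = S.curve 0 ∧
      (UniformContinuous S.curve → UniformContinuous Γ) ∧
      (∀ C ρ, 0 ≤ ρ → HolderReal C ρ S.curve → (∀ i, S.ratio i ≤ S.len i ^ ρ) →
        ∃ C', HolderReal C' ρ Γ) := by
  obtain ⟨P, hP⟩ := S.exists_isArcFamily
  obtain ⟨β, hβ⟩ := S.code_surj (S.curve 0)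
  obtain ⟨h, hmem, h0, h1, hlip⟩ := S.exists_time_change
  have hη := S.η_pos
  -- Zero at both ends of the interval and at least 1 off the outer fractions `θ`; since arcs are
  -- constant beyond time 1, the excursion waits at `map i (curve 0)` in between.
  let tent : ℕ → ℝ → ℝ := fun i x =>
    min (x - S.left i) (S.left i + S.len i - x) / (θ * S.len i)
  have hpos : ∀ i, 0 < θ * S.len i := fun i => mul_pos hθ (S.len_pos i)
  have htent : ∀ i x y, |tent i x - tent i y| ≤ |x - y| / (θ * S.len i) := by
    intro i x y
    simp only [tent]
    rw [← sub_div, abs_div, abs_of_pos (hpos i)]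
    exact div_le_div_of_nonneg_right (abs_tent_sub_le _ _ _ _) (hpos i).le
  let piece : ℕ → ℝ → Y := fun i x => S.map i (P (S.word i) β (tent i x))
  let Γ : ℝ → Y := glue S.left S.len piece (fun x => S.curve (h x))
  have hΓout : ∀ x, (∀ i, x ∉ Set.Ioo (S.left i) (S.left i + S.len i)) → Γ x = S.curve (h x) :=
    fun x hx => glue_of_notMem _ _ hx
  have hΓmem : ∀ i, ∀ x ∈ Set.Ioo (S.left i) (S.left i + S.len i), Γ x = piece i x :=
    fun i x hx => glue_of_mem S.isPacking_left _ _ hx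
  have hout : ∀ x, x ≤ 0 ∨ 1 ≤ x → ∀ i, x ∉ Set.Ioo (S.left i) (S.left i + S.len i) := by
    rintro x hx i ⟨hi1, hi2⟩
    have := S.le_left i
    have := S.left_add_len_le i
    rcases hx with hx | hx <;> linarith
  have hend : ∀ i e, e = S.left i ∨ e = S.left i + S.len i →
      piece i e = S.curve (S.time i) := by
    intro i e he
    have hl := S.len_pos i
    have h2 : tent i e = 0 := by
      simp only [tent]
      rcases he with rfl | rfl
      · rw [sub_self, min_eq_left (by linarith), zero_div]
      · rw [sub_self, min_eq_right (by linarith), zero_div]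
    simp only [piece]
    rw [h2, hP.start _ _ le_rfl, S.curve_time]
  have hjump : ∀ (c : ℝ) (x y : ℝ), (∀ i e, |x - e| ≤ |x - y| → dist (piece i x) (piece i e) ≤ c) →
      ∀ i, x ∈ Set.Ioo (S.left i) (S.left i + S.len i) →
      y ∉ Set.Ioo (S.left i) (S.left i + S.len i) → dist (Γ x) (S.curve (h x)) ≤ c := by
    intro c x y hc i hx hy
    obtain ⟨e, he, hxe⟩ := exists_endpoint_abs_sub_le hx hy
    rw [hΓmem i x hx, hmem i x ⟨hx.1.le, hx.2.le⟩, ← hend i e he]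
    exact hc i e hxe
  refine ⟨fun i => S.left i + θ * S.len i, Γ, fun i => ?_, fun i => ?_, fun i j hij => ?_,
    fun i x hx => ?_, ?_, ?_, fun hγ => ?_, fun C ρ hρ hγ hlen => ?_⟩
  · linarith [S.le_left i, hpos i]
  · linarith [S.left_add_len_le i, hpos i]
  · rcases S.isPacking_left i j hij with h | h
    · exact Or.inl (by linarith [hpos i, hpos j])
    · exact Or.inr (by linarith [hpos i, hpos j])
  · have hp := hpos i
    obtain ⟨hx1, hx2⟩ := hx
    rw [hΓmem i x ⟨by linarith, by linarith⟩]
    simp only [piece]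
    rw [hP.finish, hβ]
    simp only [tent]
    rw [one_le_div hp]
    exact le_min (by linarith) (by linarith)
  · rw [hΓout 0 (hout 0 (Or.inl le_rfl)), h0 0 le_rfl]
  · rw [hΓout 1 (hout 1 (Or.inr le_rfl)), h1 1 le_rfl]
  · refine Metric.uniformContinuous_iff.2 fun ε hε => ?_
    obtain ⟨δ₁, hδ₁, H₁⟩ := S.uniformContinuous_curve_comp hγ (show 0 < ε / 4 by positivity)
    obtain ⟨δ₂, hδ₂, H₂⟩ := S.exists_uniform_delta hr (fun _ (k : ℝ × ℝ) => |k.1 - k.2|)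
      (fun i k => P (S.word i) β (tent i k.1)) (fun i k => P (S.word i) β (tent i k.2)) le_rfl
      (fun i ε hε => by
        obtain ⟨δ, hδ, H⟩ :=
          Metric.uniformContinuous_iff.1 (hP.uniformContinuous hγ (S.word i) β) ε hε
        refine ⟨δ * (θ * S.len i), mul_pos hδ (hpos i), fun k hk => ?_⟩
        rw [add_zero]
        refine (H ?_).le
        rw [Real.dist_eq]
        refine (htent i _ _).trans_lt ?_
        rwa [div_lt_iff₀ (hpos i)]) (show 0 < ε / 4 by positivity)
    have H₃ : ∀ i x y, |x - y| < δ₂ → dist (piece i x) (piece i y) ≤ ε / 4 := fun i x y hxy => by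
      simpa using H₂ i (x, y) hxy
    refine ⟨min δ₁ δ₂, lt_min hδ₁ hδ₂, fun x y hxy => ?_⟩
    rw [Real.dist_eq, lt_min_iff] at hxy
    have := dist_glue_le hΓout (x := x) (y := y) (c₁ := ε / 4) (c₂ := ε / 4) (by positivity)
      (H₁ _ _ _ hxy.1 (hlip x y))
      (hjump _ _ _ fun i e he => H₃ i x e (he.trans_lt hxy.2))
      (hjump _ _ _ fun i e he => H₃ i y e (he.trans_lt (by rw [abs_sub_comm]; exact hxy.2)))
      (fun i hx hy => by
        rw [hΓmem i x hx, hΓmem i y hy]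
        linarith [H₃ i x y hxy.2])
    linarith
  · have hC := hγ.nonneg
    set K := C / S.η ^ ρ + S.D + S.D / S.η ^ ρ + C / S.η ^ ρ
    have hK : 0 ≤ K := (hP.holder hρ hγ hlen β β).nonneg
    have hθρ : 0 < θ ^ ρ := Real.rpow_pos_of_pos hθ ρ
    -- One constant serves every excursion: `ratio i` absorbs the compression by `len i`, and only
    -- `θ ^ (-ρ)` is lost.
    have H : ∀ i x y u, |x - y| ≤ u → dist (piece i x) (piece i y) ≤ K / θ ^ ρ * u ^ ρ := by
      intro i x y u hu
      have hu0 := (abs_nonneg _).trans hu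
      have h2 := hP.holder hρ hγ hlen (S.word i) β (tent i x) (tent i y)
      have h3 : |tent i x - tent i y| ^ ρ ≤ ((u / θ) / S.len i) ^ ρ := by
        refine Real.rpow_le_rpow (abs_nonneg _) ((htent i x y).trans ?_) hρ
        rw [div_div]
        gcongr
        exact (hpos i).le
      have h4 := mul_div_rpow_le (S.len_pos i) (hlen i) (div_nonneg hu0 hθ.le)
      calc dist (piece i x) (piece i y)
          ≤ S.ratio i * (K * |tent i x - tent i y| ^ ρ) := S.dist_map_le h2
        _ ≤ S.ratio i * (K * ((u / θ) / S.len i) ^ ρ) := by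
            gcongr
            exact S.ratio_nonneg i
        _ = K * (S.ratio i * ((u / θ) / S.len i) ^ ρ) := by ring
        _ ≤ K * (u / θ) ^ ρ := by gcongr
        _ = K / θ ^ ρ * u ^ ρ := by rw [Real.div_rpow hu0 hθ.le]; ring
    refine ⟨C / S.η ^ ρ + 2 * (K / θ ^ ρ), fun x y => ?_⟩
    have hu : 0 ≤ |x - y| ^ ρ := Real.rpow_nonneg (abs_nonneg _) ρ
    have hA : 0 ≤ C / S.η ^ ρ * |x - y| ^ ρ := by positivity
    have hB : 0 ≤ K / θ ^ ρ * |x - y| ^ ρ := by positivity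
    have := dist_glue_le hΓout (x := x) (y := y) (c₁ := C / S.η ^ ρ * |x - y| ^ ρ)
      (c₂ := K / θ ^ ρ * |x - y| ^ ρ) hB
      (S.holder_curve_comp hρ hγ (hlip x y))
      (hjump _ _ _ fun i e he => H i x e _ he)
      (hjump _ _ _ fun i e he => H i y e _ (by rwa [abs_sub_comm x]))
      (fun i hx hy => by
        rw [hΓmem i x hx, hΓmem i y hy]
        linarith [H i x y _ le_rfl])
    linarith

end CurveSystem

/-! ### The self-similar curve. -/

namespace CurveSystem

variable {Y : Type*} [MetricSpace Y] (S : CurveSystem Y)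

/-- A curve which contains rescaled copies of itself under all of the maps; it is continuous or
Hölder if the given curve is, and its image is dense. -/
theorem exists_self_similar_curve [CompleteSpace Y]
    (hr : Filter.Tendsto S.ratio Filter.atTop (nhds 0)) {θ : ℝ} (hθ : 0 < θ) (hθ' : θ < 1 / 2) :
    ∃ f : ℝ → Y, (∀ y, ∀ ε > 0, ∃ x ∈ Set.Icc (0 : ℝ) 1, dist (f x) y < ε) ∧
      (UniformContinuous S.curve → UniformContinuous f) ∧
      (∀ C ρ, 0 ≤ ρ → HolderReal C ρ S.curve →
        (∀ i, S.ratio i ≤ ((1 - 2 * θ) * S.len i) ^ ρ) → ∃ C', HolderReal C' ρ f) := by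
  classical
  obtain ⟨a, Γ, ha, ha', hpack, hdwell, hΓ0, hΓ1, hcont, hholder⟩ :=
    S.exists_dwelling_curve hr hθ
  have hη := S.η_pos
  have hr0 := S.r_nonneg
  have hD := S.D_nonneg
  set l : ℕ → ℝ := fun i => (1 - 2 * θ) * S.len i with hl
  have hlpos : ∀ i, 0 < l i := fun i => mul_pos (by linarith) (S.len_pos i)
  change ∀ i, a i + l i ≤ 1 - S.η at ha'
  change ∀ i, ∀ x ∈ Set.Icc (a i) (a i + l i), Γ x = S.map i (S.curve 0) at hdwell
  have : Nonempty Y := ⟨S.curve 0⟩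
  obtain ⟨f, hf⟩ := exists_fixed_of_uniform_contraction S.dist_le S.r_nonneg S.r_lt_one
    (fun f => glue a l (fun i x => S.map i (f ((x - a i) / l i))) Γ) (by
      intro f g c h x
      have hc : 0 ≤ c := dist_nonneg.trans (h x)
      simp only [glue]
      split_ifs
      · exact S.dist_map_le_r (h _)
      · rw [dist_self]; exact mul_nonneg S.r_nonneg hc)
  have hout : ∀ x, (∀ i, x ∉ Set.Ioo (a i) (a i + l i)) → f x = Γ x := fun x hx => by
    rw [← hf]; exact glue_of_notMem _ _ hx
  have hmem : ∀ i, ∀ x ∈ Set.Ioo (a i) (a i + l i), f x = S.map i (f ((x - a i) / l i)) :=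
    fun i x hx => by
      conv_lhs => rw [← hf]
      exact glue_of_mem hpack _ _ hx
  have hdist : ∀ i x y, |(x - a i) / l i - (y - a i) / l i| = |x - y| / l i := by
    intro i x y
    rw [← sub_div, abs_div, abs_of_pos (hlpos i)]
    congr 2; ring
  refine ⟨f, ?_, fun hγ => ?_, fun C ρ hρ hγ hlen => ?_⟩
  -- Density follows by descending into the nested time intervals along `w`; `x` stays interior
  -- because the copies live on open intervals.
  · have key : ∀ n : ℕ, ∀ w, ∃ x ∈ Set.Ioo (0 : ℝ) 1, dist (f x) (S.code w) ≤ S.r ^ n * S.D := by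
      intro n
      induction n with
      | zero => exact fun w => ⟨1 / 2, by norm_num, by simpa using S.dist_le _ _⟩
      | succ n ih =>
        intro w
        obtain ⟨x, hx, h⟩ := ih (tail w)
        have h1 := hlpos (w 0)
        have h2 := mul_pos h1 hx.1
        have h3 : l (w 0) * x < l (w 0) := mul_lt_of_lt_one_right h1 hx.2
        have h4 := ha (w 0)
        have h5 := ha' (w 0)
        refine ⟨a (w 0) + l (w 0) * x, ⟨by linarith, by linarith⟩, ?_⟩
        rw [hmem (w 0) _ ⟨by linarith, by linarith⟩, S.code_eq w, add_sub_cancel_left,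
          mul_div_cancel_left₀ _ h1.ne', pow_succ', mul_assoc]
        exact S.dist_map_le_r h
    intro y ε hε
    obtain ⟨w, rfl⟩ := S.code_surj y
    have h1 := (tendsto_pow_atTop_nhds_zero_of_lt_one S.r_nonneg S.r_lt_one).mul_const S.D
    rw [zero_mul] at h1
    obtain ⟨n, hn⟩ := (h1.eventually (gt_mem_nhds hε)).exists
    obtain ⟨x, hx, h⟩ := key n w
    exact ⟨x, ⟨hx.1.le, hx.2.le⟩, h.trans_lt hn⟩
  · have hΓ := Metric.uniformContinuous_iff.1 (hcont hγ)
    -- All dwelling intervals keep distance `η` from 0 and 1, so near these times `f` is just `Γ`.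
    have hends : ∀ ε > 0, ∃ δ > 0, ∀ x e, (e = 0 ∨ e = 1) → |x - e| < δ →
        dist (f x) (S.curve 0) ≤ ε := by
      intro ε hε
      obtain ⟨δ, hδ, H⟩ := hΓ ε hε
      refine ⟨min δ S.η, lt_min hδ hη, fun x e he hx => ?_⟩
      obtain ⟨hx1, hx2⟩ := lt_min_iff.1 hx
      rw [abs_lt] at hx2
      rw [hout x]
      · have hΓe : Γ e = S.curve 0 := by rcases he with rfl | rfl <;> assumption
        rw [← hΓe]
        exact (H (by rwa [Real.dist_eq])).le
      · rintro i ⟨hi1, hi2⟩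
        have := ha i
        have := ha' i
        rcases he with rfl | rfl <;> linarith
    -- On the `i`-th interval `f` and `Γ` are the images under `map i` of `f` at the rescaled time
    -- and of its common end value. Crossing an endpoint therefore means that the rescaled time is
    -- near 0 or 1.
    have hjump : ∀ ε > 0, ∃ δ > 0, ∀ i x y, |x - y| < δ → x ∈ Set.Ioo (a i) (a i + l i) →
        y ∉ Set.Ioo (a i) (a i + l i) → dist (f x) (Γ x) ≤ ε := by
      intro ε hε
      have H : ∀ e : ℝ, e = 0 ∨ e = 1 → ∃ δ > 0, ∀ (i : ℕ) (x : ℝ), |x - (a i + e * l i)| < δ →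
          dist (S.map i (f ((x - a i) / l i))) (S.map i (S.curve 0)) ≤ ε + S.r * 0 := by
        intro e he
        refine S.exists_uniform_delta hr (fun i x => |x - (a i + e * l i)|)
          (fun i x => f ((x - a i) / l i)) (fun _ _ => S.curve 0) le_rfl (fun i ε hε => ?_) hε
        obtain ⟨δ, hδ, H⟩ := hends ε hε
        refine ⟨δ * l i, mul_pos hδ (hlpos i), fun x hx => ?_⟩
        rw [add_zero]
        refine H _ e he ?_
        have h1 := hdist i x (a i + e * l i)
        rw [add_sub_cancel_left, mul_div_cancel_right₀ _ (hlpos i).ne'] at h1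
        rwa [h1, div_lt_iff₀ (hlpos i)]
      obtain ⟨δ₀, hδ₀, H₀⟩ := H 0 (Or.inl rfl)
      obtain ⟨δ₁, hδ₁, H₁⟩ := H 1 (Or.inr rfl)
      refine ⟨min δ₀ δ₁, lt_min hδ₀ hδ₁, fun i x y hxy hx hy => ?_⟩
      obtain ⟨hxy₀, hxy₁⟩ := lt_min_iff.1 hxy
      obtain ⟨e, he, hxe⟩ := exists_endpoint_abs_sub_le hx hy
      rw [hmem i x hx, hdwell i x ⟨hx.1.le, hx.2.le⟩]
      rcases he with rfl | rfl
      · simpa using H₀ i x (by simpa using hxe.trans_lt hxy₀)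
      · simpa using H₁ i x (by simpa using hxe.trans_lt hxy₁)
    have key : ∀ n : ℕ, ∀ ε > 0, ∃ δ > 0, ∀ x y, |x - y| < δ →
        dist (f x) (f y) ≤ ε + S.r ^ n * S.D := by
      intro n
      induction n with
      | zero => exact fun ε hε => ⟨1, one_pos, fun x y _ => by
          simpa using (S.dist_le _ _).trans (by linarith)⟩
      | succ n ih =>
        intro ε hε
        have hn := mul_nonneg (pow_nonneg hr0 n) hD
        have hn' := mul_nonneg (pow_nonneg hr0 (n + 1)) hD
        obtain ⟨δ₁, hδ₁, H₁⟩ := hΓ (ε / 4) (by positivity)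
        obtain ⟨δ₂, hδ₂, H₂⟩ := hjump (ε / 4) (by positivity)
        obtain ⟨δ₃, hδ₃, H₃⟩ := S.exists_uniform_delta hr (fun _ (k : ℝ × ℝ) => |k.1 - k.2|)
          (fun i k => f ((k.1 - a i) / l i)) (fun i k => f ((k.2 - a i) / l i)) hn
          (fun i ε hε => by
            obtain ⟨δ, hδ, H⟩ := ih ε hε
            refine ⟨δ * l i, mul_pos hδ (hlpos i), fun k hk => H _ _ ?_⟩
            rwa [hdist, div_lt_iff₀ (hlpos i)]) (show 0 < ε / 4 by positivity)
        refine ⟨min δ₁ (min δ₂ δ₃), by positivity, fun x y hxy => ?_⟩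
        simp only [lt_min_iff] at hxy
        obtain ⟨hxy1, hxy2, hxy3⟩ := hxy
        have := dist_glue_le hout (x := x) (y := y)
          (c₁ := ε / 4 + S.r ^ (n + 1) * S.D) (c₂ := ε / 4) (by positivity)
          ((H₁ (by rwa [Real.dist_eq])).le.trans (by linarith))
          (fun i hx hy => H₂ i x y hxy2 hx hy)
          (fun i hy hx => H₂ i y x (by rwa [abs_sub_comm]) hy hx)
          (fun i hx hy => by
            rw [hmem i x hx, hmem i y hy]
            refine (H₃ i (x, y) hxy3).trans ?_
            rw [pow_succ']
            linarith)
        linarith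
    refine Metric.uniformContinuous_iff.2 fun ε hε => ?_
    have h1 := (tendsto_pow_atTop_nhds_zero_of_lt_one S.r_nonneg S.r_lt_one).mul_const S.D
    rw [zero_mul] at h1
    obtain ⟨n, hn⟩ := (h1.eventually (gt_mem_nhds (half_pos hε))).exists
    obtain ⟨δ, hδ, H⟩ := key n (ε / 2) (half_pos hε)
    exact ⟨δ, hδ, fun x y hxy => by linarith [H x y (by rwa [Real.dist_eq] at hxy)]⟩
  · obtain ⟨K, hK⟩ := hholder C ρ hρ hγ fun i => (hlen i).trans (by
      have := hlpos i
      have := S.len_pos i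
      refine Real.rpow_le_rpow (hlpos i).le ?_ hρ
      nlinarith)
    have hK0 := hK.nonneg
    have hηρ : 0 < S.η ^ ρ := Real.rpow_pos_of_pos hη ρ
    set E := K + S.D / S.η ^ ρ with hE
    have hE0 : 0 ≤ E := by positivity
    have hends : ∀ x e, (e = 0 ∨ e = 1) → dist (f x) (S.curve 0) ≤ E * |x - e| ^ ρ := by
      intro x e he
      have hu : 0 ≤ |x - e| ^ ρ := Real.rpow_nonneg (abs_nonneg _) ρ
      have h1 : 0 ≤ K * |x - e| ^ ρ := by positivity
      have h2 : 0 ≤ S.D / S.η ^ ρ * |x - e| ^ ρ := by positivity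
      rw [hE, add_mul]
      by_cases hx : ∃ i, x ∈ Set.Ioo (a i) (a i + l i)
      · obtain ⟨i, hi1, hi2⟩ := hx
        have h3 := ha i
        have h4 := ha' i
        have h5 : S.η ≤ |x - e| := by
          rcases he with rfl | rfl
          · exact le_trans (by linarith) (le_abs_self _)
          · rw [abs_sub_comm]
            exact le_trans (by linarith) (le_abs_self _)
        linarith [S.dist_le_of_η_le hρ h5 (f x) (S.curve 0)]
      · have hΓe : Γ e = S.curve 0 := by rcases he with rfl | rfl <;> assumption
        push Not at hx
        rw [hout x hx, ← hΓe]
        linarith [hK x e]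
    have hjump : ∀ i x y u, |x - y| = u → x ∈ Set.Ioo (a i) (a i + l i) →
        y ∉ Set.Ioo (a i) (a i + l i) → dist (f x) (Γ x) ≤ E * u ^ ρ := by
      intro i x y u hu hx hy
      obtain ⟨e, he, hxe⟩ := exists_endpoint_abs_sub_le hx hy
      have he' : (e - a i) / l i = 0 ∨ (e - a i) / l i = 1 := by
        rcases he with rfl | rfl
        · left; simp
        · right; rw [add_sub_cancel_left, div_self (hlpos i).ne']
      rw [hmem i x hx, hdwell i x ⟨hx.1.le, hx.2.le⟩, ← hu]
      have h1 := S.dist_map_le (i := i) (hends ((x - a i) / l i) _ he')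
      rw [hdist] at h1
      have h2 := mul_le_mul_of_nonneg_left
        (mul_div_rpow_le (hlpos i) (hlen i) (abs_nonneg (x - e))) hE0
      have h3 : |x - e| ^ ρ ≤ |x - y| ^ ρ := Real.rpow_le_rpow (abs_nonneg _) hxe hρ
      have h4 := mul_le_mul_of_nonneg_left h3 hE0
      linarith
    -- Two times in one interval rescale with the same constant; otherwise `Γ` contributes `K` and
    -- each of the two deviations `E`, with no recursion.
    have key : ∀ n : ℕ, ∀ x y, dist (f x) (f y) ≤ (K + 2 * E) * |x - y| ^ ρ + S.r ^ n * S.D := by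
      intro n
      induction n with
      | zero =>
        intro x y
        have hu : 0 ≤ (K + 2 * E) * |x - y| ^ ρ :=
          mul_nonneg (by positivity) (Real.rpow_nonneg (abs_nonneg _) ρ)
        simpa using (S.dist_le _ _).trans (by linarith)
      | succ n ih =>
        intro x y
        have hn' := mul_nonneg (pow_nonneg hr0 (n + 1)) hD
        have hu : 0 ≤ |x - y| ^ ρ := Real.rpow_nonneg (abs_nonneg _) ρ
        have := dist_glue_le hout (x := x) (y := y)
          (c₁ := K * |x - y| ^ ρ + S.r ^ (n + 1) * S.D) (c₂ := E * |x - y| ^ ρ) (by positivity)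
          ((hK x y).trans (by linarith))
          (fun i hx hy => hjump i x y _ rfl hx hy)
          (fun i hy hx => hjump i y x _ (abs_sub_comm _ _) hy hx)
          (fun i hx hy => by
            rw [hmem i x hx, hmem i y hy]
            have h1 := ih ((x - a i) / l i) ((y - a i) / l i)
            rw [hdist] at h1
            linarith [S.dist_map_scale (by positivity) (hlpos i) (abs_nonneg (x - y)) (hlen i) h1])
        linarith
    exact ⟨K + 2 * E, fun x y =>
      le_of_forall_le_add_pow_mul S.r_nonneg S.r_lt_one fun n => key n x y⟩

end CurveSystem

/-! ### The attractor as a curve system. -/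

section Attractor

variable {X : Type*} [MetricSpace X]

/-- The infimum is attained: every difference quotient is a lower bound of the admissible constants.
-/
theorem lipschitzWith_lip {f : X → X} (hf : ∃ L : ℝ≥0, LipschitzWith L f) :
    LipschitzWith (lip f) f := by
  obtain ⟨L₀, hL₀⟩ := hf
  have hne : {L : ℝ≥0 | 0 < L ∧ LipschitzWith L f}.Nonempty :=
    ⟨L₀ + 1, by positivity, hL₀.weaken (by simp)⟩
  refine LipschitzWith.of_dist_le_mul fun x y => ?_
  rcases eq_or_ne x y with rfl | hxy
  · simp
  have hpos : 0 < nndist x y := by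
    rw [← NNReal.coe_pos, coe_nndist]; exact dist_pos.2 hxy
  have h : nndist (f x) (f y) / nndist x y ≤ lip f := by
    refine le_csInf hne fun L hL => ?_
    rw [div_le_iff₀ hpos]
    exact hL.2.nndist_le x y
  rw [div_le_iff₀ hpos] at h
  exact_mod_cast h

theorem exists_uniform_ratio {L : ℕ → ℝ} (h : Filter.Tendsto L Filter.atTop (nhds 0))
    (h1 : ∀ i, L i < 1) : ∃ r < 1, ∀ i, L i ≤ r := by
  obtain ⟨N, hN⟩ := Filter.eventually_atTop.1
    (h.eventually (gt_mem_nhds (show (0 : ℝ) < 1 / 2 by norm_num)))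
  have : ∀ n, ∃ r < 1, (1 : ℝ) / 2 ≤ r ∧ ∀ i < n, L i ≤ r := by
    intro n
    induction n with
    | zero => exact ⟨1 / 2, by norm_num, le_rfl, by simp⟩
    | succ n ih =>
      obtain ⟨r, hr, hr', H⟩ := ih
      refine ⟨max r (L n), max_lt hr (h1 n), hr'.trans (le_max_left _ _), fun i hi => ?_⟩
      rcases Nat.lt_succ_iff_lt_or_eq.1 hi with hi | rfl
      · exact (H i hi).trans (le_max_left _ _)
      · exact le_max_right _ _
  obtain ⟨r, hr, hr', H⟩ := this N
  refine ⟨r, hr, fun i => ?_⟩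
  rcases lt_or_ge i N with hi | hi
  · exact H i hi
  · exact (hN i hi).le.trans hr'

/-- The coding map of the attractor. -/
theorem exists_code [CompleteSpace X] [Nonempty X] {φ : ℕ → X → X} {D r : ℝ}
    (hD : ∀ x y : X, dist x y ≤ D) (hr1 : r < 1)
    (hφ : ∀ i x y, dist (φ i x) (φ i y) ≤ r * dist x y) (hr0 : 0 ≤ r) :
    ∃ code : (ℕ → ℕ) → X, (∀ w, code w = φ (w 0) (code (tail w))) ∧
      Set.range code = attractor φ := by
  have hφ' : ∀ i x y c, dist x y ≤ c → dist (φ i x) (φ i y) ≤ r * c := fun i x y c h =>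
    (hφ i x y).trans (mul_le_mul_of_nonneg_left h hr0)
  obtain ⟨code, hcode⟩ := exists_fixed_of_uniform_contraction hD hr0 hr1
    (fun (g : (ℕ → ℕ) → X) w => φ (w 0) (g (tail w)))
    (fun f g c h w => hφ' _ _ _ _ (h _))
  have heq : ∀ w, code w = φ (w 0) (code (tail w)) := fun w => (congrFun hcode w).symm
  have htail : ∀ n (w : ℕ → ℕ), (tail^[n] w) 0 = w n := by
    intro n
    induction n with
    | zero => exact fun w => rfl
    | succ n ih => exact fun w => by rw [Function.iterate_succ_apply, ih]; rfl
  have hword : ∀ w n, code w = wordMap φ w n (code (tail^[n] w)) := by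
    intro w n
    induction n with
    | zero => rfl
    | succ n ih =>
      rw [ih, heq (tail^[n] w), htail, Function.iterate_succ_apply']
      rfl
  have hdist : ∀ w n x y, dist (wordMap φ w n x) (wordMap φ w n y) ≤ r ^ n * dist x y := by
    intro w n
    induction n with
    | zero => intro x y; simp [wordMap]
    | succ n ih =>
      intro x y
      refine (ih _ _).trans ?_
      rw [pow_succ, mul_assoc]
      exact mul_le_mul_of_nonneg_left (hφ _ _ _) (pow_nonneg hr0 n)
  refine ⟨code, heq, Set.Subset.antisymm ?_ ?_⟩
  · rintro _ ⟨w, rfl⟩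
    exact Set.mem_iUnion.2 ⟨w, Set.mem_iInter.2 fun n => ⟨_, (hword w (n + 1)).symm⟩⟩
  · intro x hx
    obtain ⟨w, hw⟩ := Set.mem_iUnion.1 hx
    -- Both `x` and `code w` lie in the image of `wordMap φ w (n + 1)`, whose diameter is at most `r
    -- ^ (n + 1) * D`.
    refine ⟨w, dist_le_zero.1 (le_of_forall_le_add_pow_mul (D := r * D) hr0 hr1 fun n => ?_)⟩
    obtain ⟨y, rfl⟩ := Set.mem_iInter.1 hw n
    rw [hword w (n + 1), zero_add, ← mul_assoc, ← pow_succ]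
    exact (hdist w (n + 1) _ _).trans (mul_le_mul_of_nonneg_left (hD _ _) (pow_nonneg hr0 _))

/-- The attractor is the image of a curve which is Hölder with exponent `ρ` whenever the given
curve is and the lengths of the time intervals are large enough. -/
theorem exists_curve_onto_attractor [CompactSpace X] {φ : ℕ → X → X} (hφ : IsIIFS φ)
    (hK : IsCompact (attractor φ))
    (hlip : Filter.Tendsto (fun i => lip (φ i)) Filter.atTop (nhds 0))
    {γ : I → X} (hγ : Continuous γ) (hγK : Set.range γ ⊆ attractor φ)
    (hmeet : ∀ i, (Set.range γ ∩ φ i '' attractor φ).Nonempty)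
    {len : ℕ → ℝ} (hpos : ∀ i, 0 < len i) (hsum : Summable len) (hlt : ∑' i, len i < 1)
    {θ : ℝ} (hθ : 0 < θ) (hθ' : θ < 1 / 2) :
    ∃ f : I → X, Continuous f ∧ Set.range f = attractor φ ∧
      ∀ C ρ : ℝ, 0 ≤ ρ → (∀ x y : I, dist (γ x) (γ y) ≤ C * dist x y ^ ρ) →
        (∀ i, (lip (φ i) : ℝ) ≤ ((1 - 2 * θ) * len i) ^ ρ) →
        ∃ C' : ℝ, ∀ x y : I, dist (f x) (f y) ≤ C' * dist x y ^ ρ := by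
  have : Nonempty X := ⟨γ 0⟩
  have hlip' : Filter.Tendsto (fun i => (lip (φ i) : ℝ)) Filter.atTop (nhds 0) := by
    simpa only [NNReal.coe_zero] using NNReal.tendsto_coe.2 hlip
  obtain ⟨r, hr1, hr⟩ := exists_uniform_ratio hlip' fun i => by exact_mod_cast hφ.lip_lt_one i
  have hr0 : 0 ≤ r := (NNReal.coe_nonneg _).trans (hr 0)
  have hdist : ∀ i x y, dist (φ i x) (φ i y) ≤ lip (φ i) * dist x y := fun i x y =>
    (lipschitzWith_lip (hφ.lipschitz i)).dist_le_mul x y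
  have hD : ∀ x y : X, dist x y ≤ Metric.diam (Set.univ : Set X) := fun x y =>
    Metric.dist_le_diam_of_mem isCompact_univ.isBounded (Set.mem_univ _) (Set.mem_univ _)
  obtain ⟨code, hcode, hrange⟩ := exists_code hD hr1 (fun i x y => (hdist i x y).trans
    (mul_le_mul_of_nonneg_right (hr i) dist_nonneg)) hr0
  have hcodeK : ∀ w, code w ∈ attractor φ := fun w => hrange ▸ Set.mem_range_self w
  have hmapK : ∀ i, ∀ x ∈ attractor φ, φ i x ∈ attractor φ := by
    intro i x hx
    rw [← hrange] at hx
    obtain ⟨w, rfl⟩ := hx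
    -- The letter `i` is put in front of `w`.
    have := hcode (fun n => Nat.casesOn n i w)
    change _ = φ i (code w) at this
    exact this ▸ hcodeK _
  have hmeet' : ∀ i, ∃ t : I, ∃ w, γ t = φ i (code w) := by
    intro i
    obtain ⟨_, ⟨t, rfl⟩, x, hx, hxt⟩ := hmeet i
    rw [← hrange] at hx
    obtain ⟨w, rfl⟩ := hx
    exact ⟨t, w, hxt.symm⟩
  choose t κ ht using hmeet'
  have : CompleteSpace (attractor φ) := hK.isComplete.completeSpace_coe
  let S : CurveSystem (attractor φ) :=
    { map := fun i x => ⟨φ i x, hmapK i x x.2⟩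
      ratio := fun i => lip (φ i)
      r := r
      D := Metric.diam (Set.univ : Set X)
      ratio_nonneg := fun i => NNReal.coe_nonneg _
      ratio_le := hr
      r_lt_one := hr1
      dist_map := fun i x y => hdist i x y
      dist_le := fun x y => hD x y
      code := fun w => ⟨code w, hcodeK w⟩
      code_eq := fun w => Subtype.ext (hcode w)
      code_surj := fun ⟨x, hx⟩ => by
        rw [← hrange] at hx
        obtain ⟨w, rfl⟩ := hx
        exact ⟨w, rfl⟩
      curve := fun x => ⟨γ (Set.projIcc 0 1 zero_le_one x), hγK (Set.mem_range_self _)⟩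
      time := fun i => t i
      time_mem := fun i => (t i).2
      word := κ
      curve_time := fun i => Subtype.ext (by
        change γ (Set.projIcc 0 1 zero_le_one (t i : ℝ)) = _
        rw [Set.projIcc_val]
        exact ht i)
      len := len
      len_pos := hpos
      len_summable := hsum
      -- The time not used by the intervals, in three equal shares.
      η := (1 - ∑' i, len i) / 3
      η_pos := by linarith
      len_sum := by linarith }
  obtain ⟨f, hdense, hcont, hholder⟩ := S.exists_self_similar_curve hlip' hθ hθ'
  have hproj : LipschitzWith 1 (Set.projIcc (0 : ℝ) 1 zero_le_one) :=
    LipschitzWith.projIcc zero_le_one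
  have hScurve : UniformContinuous S.curve :=
    ((CompactSpace.uniformContinuous_of_continuous hγ).comp
      hproj.uniformContinuous).subtype_mk _
  have hf : Continuous f := (hcont hScurve).continuous
  refine ⟨fun x => f x, continuous_subtype_val.comp (hf.comp continuous_subtype_val), ?_, ?_⟩
  · refine Set.Subset.antisymm ?_ fun y hy => ?_
    · rintro _ ⟨x, rfl⟩
      exact (f x).2
    · have hclosed : IsClosed (f '' Set.Icc 0 1) := (isCompact_Icc.image hf).isClosed
      have hmem : (⟨y, hy⟩ : attractor φ) ∈ f '' Set.Icc 0 1 := by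
        rw [← hclosed.closure_eq, Metric.mem_closure_iff]
        intro ε hε
        obtain ⟨x, hx, h⟩ := hdense ⟨y, hy⟩ ε hε
        exact ⟨f x, ⟨x, hx, rfl⟩, by rwa [dist_comm]⟩
      obtain ⟨x, hx, h⟩ := hmem
      exact ⟨⟨x, hx⟩, congrArg Subtype.val h⟩
  · intro C ρ hρ hC hlen
    have hC0 : 0 ≤ C := by
      have := dist_nonneg.trans (hC 0 1)
      simpa [Subtype.dist_eq] using this
    obtain ⟨C', hC'⟩ := hholder C ρ hρ (fun x y => by
      refine (hC _ _).trans ?_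
      gcongr
      simpa [Real.dist_eq] using hproj.dist_le_mul x y) hlen
    exact ⟨C', fun x y => hC' x y⟩

/-- Some `t < α` has `ψ(t) ≤ 1`, and raising the exponent to `α` gains the factor `r ^ (α - t) < 1`
in every term. -/
theorem tsum_lip_rpow_lt_one {φ : ℕ → X → X} (hφ : IsIIFS φ) {r : ℝ} (hr1 : r < 1)
    (hr : ∀ i, (lip (φ i) : ℝ) ≤ r) {α : ℝ≥0} (hα : sdim φ < α) :
    Summable (fun i => (lip (φ i) : ℝ) ^ (α : ℝ)) ∧ ∑' i, (lip (φ i) : ℝ) ^ (α : ℝ) < 1 := by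
  have hr0 : 0 ≤ r := (NNReal.coe_nonneg _).trans (hr 0)
  obtain ⟨_, ⟨t, ht, rfl⟩, htα⟩ := sInf_lt_iff.1 hα
  have htα' : (t : ℝ) < α := NNReal.coe_lt_coe.2 (ENNReal.coe_lt_coe.1 htα)
  have hψ : ∑' i, ((lip (φ i) ^ (t : ℝ) : ℝ≥0) : ℝ≥0∞) ≤ 1 := by
    refine le_of_eq_of_le (tsum_congr fun i => ?_) ht
    rw [ENNReal.coe_rpow_of_nonneg _ t.coe_nonneg]
  have hs : Summable fun i => lip (φ i) ^ (t : ℝ) :=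
    ENNReal.tsum_coe_ne_top_iff_summable.1 (ne_top_of_le_ne_top ENNReal.one_ne_top hψ)
  have hs1 : ∑' i, lip (φ i) ^ (t : ℝ) ≤ 1 := by
    rw [← ENNReal.coe_tsum hs] at hψ
    exact_mod_cast hψ
  have hs' : Summable fun i => (lip (φ i) : ℝ) ^ (t : ℝ) := by
    exact_mod_cast NNReal.summable_coe.2 hs
  have hs1' : ∑' i, (lip (φ i) : ℝ) ^ (t : ℝ) ≤ 1 := by exact_mod_cast hs1
  have hle : ∀ i, (lip (φ i) : ℝ) ^ (α : ℝ) ≤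
      r ^ ((α : ℝ) - t) * (lip (φ i) : ℝ) ^ (t : ℝ) := by
    intro i
    have hpos : (0 : ℝ) < lip (φ i) := hφ.lip_pos i
    calc (lip (φ i) : ℝ) ^ (α : ℝ)
        = (lip (φ i) : ℝ) ^ ((α : ℝ) - t) * (lip (φ i) : ℝ) ^ (t : ℝ) := by
          rw [← Real.rpow_add hpos]; congr 1; ring
      _ ≤ _ := by
          gcongr
          exact hr i
  have hsα : Summable (fun i => (lip (φ i) : ℝ) ^ (α : ℝ)) :=
    Summable.of_nonneg_of_le (fun i => by positivity) hle (hs'.mul_left _)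
  refine ⟨hsα, (hsα.tsum_le_tsum hle (hs'.mul_left _)).trans_lt ?_⟩
  rw [tsum_mul_left]
  have h1 : r ^ ((α : ℝ) - t) < 1 := Real.rpow_lt_one hr0 hr1 (by linarith)
  have h2 : 0 ≤ r ^ ((α : ℝ) - t) := Real.rpow_nonneg hr0 _
  nlinarith

theorem isHolder_of_dist_le {f : I → X} {C : ℝ} {ρ : ℝ≥0}
    (h : ∀ x y : I, dist (f x) (f y) ≤ C * dist x y ^ (ρ : ℝ)) : IsHolder ρ f := by
  refine ⟨C.toNNReal, fun x y => ?_⟩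
  have h1 : dist (f x) (f y) ≤ (C.toNNReal : ℝ) * dist x y ^ (ρ : ℝ) := (h x y).trans
    (mul_le_mul_of_nonneg_right (Real.le_coe_toNNReal C) (Real.rpow_nonneg dist_nonneg _))
  have h2 : nndist (f x) (f y) ≤ C.toNNReal * nndist x y ^ (ρ : ℝ) := by exact_mod_cast h1
  rw [edist_nndist, edist_nndist, ← ENNReal.coe_rpow_of_nonneg _ ρ.coe_nonneg]
  exact_mod_cast h2

end Attractor

end IIFS

/-! ### Choice of the lengths. -/

theorem theorem1p2 {X : Type*} [MetricSpace X] [CompactSpace X]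
    (φ : ℕ → X → X) (hφ : IIFS.IsIIFS φ)
    (hK : IsCompact (IIFS.attractor φ))
    (hlip : Filter.Tendsto (fun i => IIFS.lip (φ i)) Filter.atTop (nhds 0))
    (γ : I → X) (hγ : Continuous γ)
    (hγK : Set.range γ ⊆ IIFS.attractor φ)
    (hmeet : ∀ i, (Set.range γ ∩ φ i '' IIFS.attractor φ).Nonempty) :
    (∃ f : I → X, Continuous f ∧ Set.range f = IIFS.attractor φ) ∧
    (∀ s : ℝ≥0, 1 ≤ s → IIFS.IsHolder (1 / s) γ →
      ∀ α : ℝ≥0, max (s : ℝ≥0∞) (IIFS.sdim φ) < (α : ℝ≥0∞) →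
        ∃ f : I → X, IIFS.IsHolder (1 / α) f ∧ Set.range f = IIFS.attractor φ) := by
  constructor
  -- Continuity places no lower bound on the lengths; any positive sequence with sum below 1 will
  -- do, here with sum `1 / 2`.
  · have hsum : HasSum (fun n : ℕ => 1 / 4 * (1 / 2 : ℝ) ^ n) (1 / 4 * 2) :=
      hasSum_geometric_two.mul_left _
    obtain ⟨f, hf, hrange, -⟩ := IIFS.exists_curve_onto_attractor hφ hK hlip hγ hγK hmeet
      (fun n => by positivity) hsum.summable (by rw [hsum.tsum_eq]; norm_num)
      (θ := 1 / 4) (by norm_num) (by norm_num)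
    exact ⟨f, hf, hrange⟩
  · rintro s hs ⟨C, hC⟩ α hα
    obtain ⟨hsα, hdα⟩ := max_lt_iff.1 hα
    have hsα' : s < α := by exact_mod_cast hsα
    have hα0 : (0 : ℝ) < α := by
      have : 0 < α := (zero_lt_one.trans_le hs).trans hsα'
      exact_mod_cast this
    have hs0 : (0 : ℝ) < s := by
      have : 0 < s := zero_lt_one.trans_le hs
      exact_mod_cast this
    have hlip' : Filter.Tendsto (fun i => (IIFS.lip (φ i) : ℝ)) Filter.atTop (nhds 0) := by
      simpa only [NNReal.coe_zero] using NNReal.tendsto_coe.2 hlip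
    obtain ⟨r, hr1, hr⟩ := IIFS.exists_uniform_ratio hlip'
      fun i => by exact_mod_cast hφ.lip_lt_one i
    obtain ⟨hsum, hlt⟩ := IIFS.tsum_lip_rpow_lt_one hφ hr1 hr hdα
    have hq0 : 0 ≤ ∑' i, (IIFS.lip (φ i) : ℝ) ^ (α : ℝ) := tsum_nonneg fun i => by positivity
    set q := ∑' i, (IIFS.lip (φ i) : ℝ) ^ (α : ℝ) with hq
    have hpos : ∀ i, (0 : ℝ) < IIFS.lip (φ i) := fun i => hφ.lip_pos i
    -- With `θ = (1 - q) / 4` one has `1 - 2 * θ = (1 + q) / 2`, so the dwelling intervals have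
    -- length exactly `Lip(φ i) ^ α`, while the full lengths sum to `2 * q / (1 + q) < 1`.
    obtain ⟨f, -, hrange, hf⟩ := IIFS.exists_curve_onto_attractor hφ hK hlip hγ hγK hmeet
      (len := fun i => (IIFS.lip (φ i) : ℝ) ^ (α : ℝ) / ((1 + q) / 2))
      (fun i => div_pos (Real.rpow_pos_of_pos (hpos i) _) (by linarith)) (hsum.div_const _)
      (by
        rw [tsum_div_const, ← hq, div_lt_one (by linarith)]
        linarith)
      (θ := (1 - q) / 4) (by linarith) (by linarith)
    obtain ⟨C', hC'⟩ := hf C ((1 / α : ℝ≥0) : ℝ) (NNReal.coe_nonneg _)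
      (fun x y => by
        refine (hC.dist_le x y).trans (mul_le_mul_of_nonneg_left ?_ C.2)
        have hle : dist x y ≤ 1 := by
          rw [Subtype.dist_eq, Real.dist_eq, abs_le]
          constructor <;> linarith [x.2.1, x.2.2, y.2.1, y.2.2]
        -- Distances in the unit interval are at most 1, so lowering the exponent from `1 / s` to `1
        -- / α` weakens the bound.
        refine Real.rpow_le_rpow_of_exponent_ge_of_imp dist_nonneg hle ?_ ?_
        · push_cast
          exact one_div_le_one_div_of_le hs0 (by exact_mod_cast hsα'.le)
        · intro _ h
          exfalso
          push_cast at h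
          exact (one_div_pos.2 hs0).ne' h)
      (fun i => by
        have h1 : (1 - 2 * ((1 - q) / 4)) *
            ((IIFS.lip (φ i) : ℝ) ^ (α : ℝ) / ((1 + q) / 2)) =
            (IIFS.lip (φ i) : ℝ) ^ (α : ℝ) := by
          have : 1 + q ≠ 0 := by linarith
          field_simp
          ring
        rw [h1, ← Real.rpow_mul (hpos i).le]
        push_cast
        rw [mul_one_div_cancel hα0.ne', Real.rpow_one])
    exact ⟨f, IIFS.isHolder_of_dist_le hC', hrange⟩
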